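/- Let $K$ be a field. A \emph{pre-wheeled PROP} over $K$ is a bigraded $K$-vector space $\mathcal R=\bigoplus_{p,q\ge 0}\mathcal R^p_q$ with elements $1\in\mathcal R^0_0$ and $\downarrow\,\in\mathcal R^1_1$, bilinear maps $\otimes:\mathcal R^{p_1}_{q_1}\times\mathcal R^{p_2}_{q_2}\to\mathcal R^{p_1+p_2}_{q_1+q_2}$, and linear maps $\partial^i_j:\mathcal R^p_q\to\mathcal R^{p-1}_{q-1}$ for $1\le i\le p$, $1\le j\le q$ (no axioms are imposed). A homomorphism of pre-wheeled PROPs is a linear map preserving the bigrading, $1$, $\downarrow$, $\otimes$ and all $\partial^i_j$. Let $\mathscr G$ be a set with a function $\mathbf{type}:\mathscr G\to\mathbb Z_{\ge0}^2$, and fix a countably infinite set $\mathcal X$ of variables. An \emph{atom} is an expression $A^{x_1,\dots,x_p}_{y_1,\dots,y_q}$ with $A\in\mathscr G$, $\mathbf{type}(A)=\binom pq$, distinct variables $x_1,\dots,x_p$ and distinct variables $y_1,\dots,y_q$, or an expression $\downarrow^x_y$ with variables $x,y$. A \emph{molecule} is a finite multiset of atoms in which every variable occurs at most once as an upper index and at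 most once as a lower index. Its input variables are those occurring only as an upper index, its output variables those occurring only as a lower index; the variables occurring as both are bound. A \emph{monomial} $[M]^{x_1,\dots,x_p}_{y_1,\dots,y_q}$ is a molecule $M$ with a total ordering $x_1<\dots<x_p$ of its input variables and $y_1<\dots<y_q$ of its output variables, up to the equivalence relation generated by: (1) replacing $\downarrow^x_y\downarrow^y_z$ by $\downarrow^x_z$; (2) replacing $\downarrow^{y_i}_zA^{x_1,\dots,x_p}_{y_1,\dots,y_q}$ by $A^{x_1,\dots,x_p}_{y_1,\dots,y_{i-1},z,y_{i+1},\dots,y_q}$; (3) replacing $\downarrow^z_{x_i}A^{x_1,\dots,x_p}_{y_1,\dots,y_q}$ by $A^{x_1,\dots,x_{i-1},z,x_{i+1},\dots,x_p}_{y_1,\dots,y_q}$ (in (1)--(3) the free variables and their orderings are unchanged); (4) renaming all variables by a bijection $\mathcal X\to\mathcal X$. The \emph{free wheeled PROP} $\mathcal Z\langle\mathscr G\rangle$ is the pre-wheeled PROP whose component $\mathcal Z\langle\mathscr G\rangle^p_q$ has as basis the monomials with $p$ inputs and $q$ outputs, where $1$ is the class of the empty molecule, $\downarrow\,=[\downarrow^x_y]^x_y$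 with $x\ne y$, and, on monomials, $[M]^{x_1,\dots,x_p}_{y_1,\dots,y_q}\otimes[N]^{z_1,\dots,z_r}_{w_1,\dots,w_s}=[MN]^{x_1,\dots,x_p,z_1,\dots,z_r}_{y_1,\dots,y_q,w_1,\dots,w_s}$ for representatives $M,N$ without common variables, and $\partial^i_j[M]^{x_1,\dots,x_p}_{y_1,\dots,y_q}$ is the class of the molecule obtained from $M$ by replacing $y_j$ by $x_i$, with $x_i$ and $y_j$ removed from the orderings. A generator $A$ of type $\binom pq$ is identified with the monomial $[A^{x_1,\dots,x_p}_{y_1,\dots,y_q}]^{x_1,\dots,x_p}_{y_1,\dots,y_q}$, where $x_1,\dots,x_p,y_1,\dots,y_q$ are distinct. A \emph{wheeled PROP} is a pre-wheeled PROP $\mathcal R$ for which there is a surjective homomorphism of pre-wheeled PROPs $\mathcal Z\langle\mathscr H\rangle\to\mathcal R$ for some set $\mathscr H$ with a type function; homomorphisms of wheeled PROPs are homomorphisms of pre-wheeled PROPs. \textbf{Proposition} (Universal property of free wheeled PROPs). Let $\mathscr G$ be a set with a function $\mathbf{type}:\mathscr G\to\mathbb Z_{\ge0}^2$, let $\mathcal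 R$ be a wheeled PROP, and let $\psi:\mathscr G\to\mathcal R$ be a function such that $\psi(A)\in\mathcal R^p_q$ for all $A\in\mathscr G$ with $\mathbf{type}(A)=\binom pq$. Then $\psi$ extends uniquely to a homomorphism of wheeled PROPs $\mathcal Z\langle\mathscr G\rangle\to\mathcal R$. -/

import Mathlib

universe u v w t t'

/-! ### Pre-wheeled PROPs and their homomorphisms -/

/-- A pre-wheeled PROP over `K`: a bigraded vector space, given by its homogeneous components
`obj p q` (`p` inputs, `q` outputs), with a unit, an identity, a bilinear tensor product and
contractions.  `contr i j` is the contraction of input number `i` with output number `j`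
(both numbered from `0`); no axioms are imposed. -/
structure PreWheeledPROP (K : Type u) [Field K] where
  obj : ℕ → ℕ → Type t
  [addCommGroup : ∀ p q, AddCommGroup (obj p q)]
  [module : ∀ p q, Module K (obj p q)]
  one : obj 0 0
  idn : obj 1 1
  tensor : ∀ {p₁ q₁ p₂ q₂ : ℕ}, obj p₁ q₁ →ₗ[K] obj p₂ q₂ →ₗ[K] obj (p₁ + p₂) (q₁ + q₂)
  contr : ∀ {p q : ℕ}, Fin (p + 1) → Fin (q + 1) → (obj (p + 1) (q + 1) →ₗ[K] obj p q)

attribute [instance] PreWheeledPROP.addCommGroup PreWheeledPROP.module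

/-- Homomorphisms of pre-wheeled PROPs: linear maps preserving the bigrading (that is, a linear map
on each component), the unit, the identity, tensor products and contractions. -/
structure PreWheeledPROP.Hom {K : Type u} [Field K]
    (R : PreWheeledPROP.{u, t} K) (S : PreWheeledPROP.{u, t'} K) where
  app : ∀ p q : ℕ, R.obj p q →ₗ[K] S.obj p q
  map_one : app 0 0 R.one = S.one
  map_idn : app 1 1 R.idn = S.idn
  map_tensor : ∀ {p₁ q₁ p₂ q₂ : ℕ} (a : R.obj p₁ q₁) (b : R.obj p₂ q₂),
    app (p₁ + p₂) (q₁ + q₂) (R.tensor a b) = S.tensor (app p₁ q₁ a) (app p₂ q₂ b)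
  map_contr : ∀ {p q : ℕ} (i : Fin (p + 1)) (j : Fin (q + 1)) (a : R.obj (p + 1) (q + 1)),
    app p q (R.contr i j a) = S.contr i j (app (p + 1) (q + 1) a)

/-- A homomorphism is surjective when it is surjective in every bidegree. -/
def PreWheeledPROP.Hom.IsSurjective {K : Type u} [Field K]
    {R : PreWheeledPROP.{u, t} K} {S : PreWheeledPROP.{u, t'} K} (φ : R.Hom S) : Prop :=
  ∀ p q : ℕ, Function.Surjective (φ.app p q)

/-! ### Atoms and molecules

Generators are the elements of a type `G`; `type A = (p, q)` means that `A` has `p` inputs and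
`q` outputs.  The countably infinite set of variables is `ℕ`. -/

/-- An atom is either `A^{x₁,…,x_p}_{y₁,…,y_q}` for a generator `A` of type `(p, q)`, or an arrow
`↓^x_y`.  (That the `xᵢ` are distinct and the `yⱼ` are distinct is part of the conditions
`nodup_ins` and `nodup_outs` on a molecule.) -/
inductive Atom {G : Type v} (type : G → ℕ × ℕ) : Type v
  | gen (A : G) (x : Fin (type A).1 → ℕ) (y : Fin (type A).2 → ℕ) : Atom type
  | arrow (x y : ℕ) : Atom type

namespace Atom

variable {G : Type v} {type : G → ℕ × ℕ}

/-- The upper indices of an atom. -/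
def ins : Atom type → Multiset ℕ
  | gen _ x _ => Finset.univ.val.map x
  | arrow x _ => {x}

/-- The lower indices of an atom. -/
def outs : Atom type → Multiset ℕ
  | gen _ _ y => Finset.univ.val.map y
  | arrow _ y => {y}

/-- Apply `f` to the upper indices and `g` to the lower indices. -/
def map (f g : ℕ → ℕ) : Atom type → Atom type
  | gen A x y => gen A (f ∘ x) (g ∘ y)
  | arrow x y => arrow (f x) (g y)

theorem ins_map (f g : ℕ → ℕ) (a : Atom type) : (a.map f g).ins = a.ins.map f := by
  cases a <;> simp only [map, ins, Multiset.map_map, Multiset.map_singleton]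

theorem outs_map (f g : ℕ → ℕ) (a : Atom type) : (a.map f g).outs = a.outs.map g := by
  cases a <;> simp only [map, outs, Multiset.map_map, Multiset.map_singleton]

theorem map_map (f g f' g' : ℕ → ℕ) (a : Atom type) :
    (a.map f g).map f' g' = a.map (f' ∘ f) (g' ∘ g) := by
  cases a <;> simp [map, Function.comp_assoc]

end Atom

/-- A molecule is an unordered finite sequence of atoms in which every variable appears at most once
as an upper index and at most once as a lower index. -/
structure Molecule {G : Type v} (type : G → ℕ × ℕ) where
  atoms : Multiset (Atom type)
  nodup_ins : (atoms.bind Atom.ins).Nodup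
  nodup_outs : (atoms.bind Atom.outs).Nodup

namespace Molecule

variable {G : Type v} {type : G → ℕ × ℕ}

/-- The input variables: those that appear as an upper but not as a lower index. -/
def inputVars (M : Molecule type) : Set ℕ :=
  {z | z ∈ M.atoms.bind Atom.ins ∧ z ∉ M.atoms.bind Atom.outs}

/-- The output variables: those that appear as a lower but not as an upper index. -/
def outputVars (M : Molecule type) : Set ℕ :=
  {z | z ∈ M.atoms.bind Atom.outs ∧ z ∉ M.atoms.bind Atom.ins}

end Molecule

/-- A molecule with total orderings `inp 0 < inp 1 < ⋯` of its `p` input variables and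
`out 0 < out 1 < ⋯` of its `q` output variables. -/
structure OrderedMolecule {G : Type v} (type : G → ℕ × ℕ) (p q : ℕ) extends Molecule type where
  inp : Fin p → ℕ
  out : Fin q → ℕ
  inp_injective : Function.Injective inp
  out_injective : Function.Injective out
  range_inp : Set.range inp = toMolecule.inputVars
  range_out : Set.range out = toMolecule.outputVars

namespace OrderedMolecule

variable {G : Type v} {type : G → ℕ × ℕ} {p q p₁ q₁ p₂ q₂ : ℕ}

/-- The elementary moves on molecules with ordered free variables.  The first three keep the free
variables and remove an arrow that is composed with another arrow, with an output of a generator,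
or with an input of a generator.  The last one renames the variables by a bijection: bound
variables are dummies, and free variables matter only through their position in the orderings. -/
inductive Move : OrderedMolecule type p q → OrderedMolecule type p q → Prop
  | arrow_arrow (M N : OrderedMolecule type p q) (x y z : ℕ) (L : Multiset (Atom type))
      (hM : M.atoms = Atom.arrow x y ::ₘ Atom.arrow y z ::ₘ L)
      (hN : N.atoms = Atom.arrow x z ::ₘ L)
      (hinp : N.inp = M.inp) (hout : N.out = M.out) : Move M N
  | gen_out (M N : OrderedMolecule type p q) (A : G) (x : Fin (type A).1 → ℕ)
      (y : Fin (type A).2 → ℕ) (i : Fin (type A).2) (z : ℕ) (L : Multiset (Atom type))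
      (hM : M.atoms = Atom.arrow (y i) z ::ₘ Atom.gen A x y ::ₘ L)
      (hN : N.atoms = Atom.gen A x (Function.update y i z) ::ₘ L)
      (hinp : N.inp = M.inp) (hout : N.out = M.out) : Move M N
  | gen_in (M N : OrderedMolecule type p q) (A : G) (x : Fin (type A).1 → ℕ)
      (y : Fin (type A).2 → ℕ) (i : Fin (type A).1) (z : ℕ) (L : Multiset (Atom type))
      (hM : M.atoms = Atom.arrow z (x i) ::ₘ Atom.gen A x y ::ₘ L)
      (hN : N.atoms = Atom.gen A (Function.update x i z) y ::ₘ L)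
      (hinp : N.inp = M.inp) (hout : N.out = M.out) : Move M N
  | rename (M N : OrderedMolecule type p q) (σ : Equiv.Perm ℕ)
      (hN : N.atoms = M.atoms.map (Atom.map σ σ))
      (hinp : N.inp = σ ∘ M.inp) (hout : N.out = σ ∘ M.out) : Move M N

theorem mem_range_inp (M : OrderedMolecule type p q) (z : ℕ) :
    (∃ k, M.inp k = z) ↔ z ∈ M.atoms.bind Atom.ins ∧ z ∉ M.atoms.bind Atom.outs := by
  have := Set.ext_iff.1 M.range_inp z
  simpa only [Set.mem_range, Molecule.inputVars, Set.mem_ofPred_eq] using this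

theorem mem_range_out (M : OrderedMolecule type p q) (z : ℕ) :
    (∃ k, M.out k = z) ↔ z ∈ M.atoms.bind Atom.outs ∧ z ∉ M.atoms.bind Atom.ins := by
  have := Set.ext_iff.1 M.range_out z
  simpa only [Set.mem_range, Molecule.outputVars, Set.mem_ofPred_eq] using this

theorem bind_ins_map (f g : ℕ → ℕ) (L : Multiset (Atom type)) :
    (L.map (Atom.map f g)).bind Atom.ins = (L.bind Atom.ins).map f := by
  simp only [Multiset.bind_map, Multiset.map_bind, Atom.ins_map]

theorem bind_outs_map (f g : ℕ → ℕ) (L : Multiset (Atom type)) :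
    (L.map (Atom.map f g)).bind Atom.outs = (L.bind Atom.outs).map g := by
  simp only [Multiset.bind_map, Multiset.map_bind, Atom.outs_map]

/-- The empty molecule. -/
def empty : OrderedMolecule type 0 0 where
  atoms := 0
  nodup_ins := by simp
  nodup_outs := by simp
  inp := Fin.elim0
  out := Fin.elim0
  inp_injective := fun i => i.elim0
  out_injective := fun i => i.elim0
  range_inp := by ext; simp [Molecule.inputVars]
  range_out := by ext; simp [Molecule.outputVars]

/-- The arrow `↓^x_y`, with the distinct variables `x = 0` and `y = 1`. -/
def arrow : OrderedMolecule type 1 1 where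
  atoms := {Atom.arrow 0 1}
  nodup_ins := by simp [Atom.ins]
  nodup_outs := by simp [Atom.outs]
  inp := fun _ => 0
  out := fun _ => 1
  inp_injective := fun i j _ => Subsingleton.elim i j
  out_injective := fun i j _ => Subsingleton.elim i j
  range_inp := by
    ext z
    simp [Molecule.inputVars, Atom.ins, Atom.outs]
    omega
  range_out := by
    ext z
    simp [Molecule.outputVars, Atom.ins, Atom.outs]
    omega

/-- A generator `A` as a molecule, with inputs `0, 2, 4, …` and outputs `1, 3, 5, …`. -/
def gen (A : G) : OrderedMolecule type (type A).1 (type A).2 where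
  atoms := {Atom.gen A (fun i => 2 * (i : ℕ)) (fun j => 2 * (j : ℕ) + 1)}
  nodup_ins := by
    simp only [Multiset.singleton_bind, Atom.ins]
    exact Finset.univ.nodup.map (fun i j h => Fin.ext (by simpa using h))
  nodup_outs := by
    simp only [Multiset.singleton_bind, Atom.outs]
    exact Finset.univ.nodup.map (fun i j h => Fin.ext (by simpa using h))
  inp := fun i => 2 * (i : ℕ)
  out := fun j => 2 * (j : ℕ) + 1
  inp_injective := fun i j h => Fin.ext (by simpa using h)
  out_injective := fun i j h => Fin.ext (by simpa using h)
  range_inp := by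
    ext z
    simp only [Molecule.inputVars, Atom.ins, Atom.outs, Multiset.singleton_bind, Set.mem_range,
      Set.mem_ofPred_eq, Multiset.mem_map, Finset.mem_val, Finset.mem_univ, true_and, not_exists]
    constructor
    · rintro ⟨i, rfl⟩
      exact ⟨⟨i, rfl⟩, fun j => by omega⟩
    · exact fun h => h.1
  range_out := by
    ext z
    simp only [Molecule.outputVars, Atom.ins, Atom.outs, Multiset.singleton_bind, Set.mem_range,
      Set.mem_ofPred_eq, Multiset.mem_map, Finset.mem_val, Finset.mem_univ, true_and, not_exists]
    constructor
    · rintro ⟨i, rfl⟩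
      exact ⟨⟨i, rfl⟩, fun j => by omega⟩
    · exact fun h => h.1

theorem double_injective : Function.Injective (fun n : ℕ => 2 * n) :=
  fun a b h => by simpa using h

theorem double_succ_injective : Function.Injective (fun n : ℕ => 2 * n + 1) :=
  fun a b h => by simpa using h

/-- The union of two multisets of atoms, after renaming the variables apart by `n ↦ 2n` and
`n ↦ 2n + 1`. -/
def disjointUnion (L L' : Multiset (Atom type)) : Multiset (Atom type) :=
  L.map (Atom.map (fun n => 2 * n) (fun n => 2 * n)) +
    L'.map (Atom.map (fun n => 2 * n + 1) (fun n => 2 * n + 1))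

theorem bind_ins_disjointUnion (L L' : Multiset (Atom type)) :
    (disjointUnion L L').bind Atom.ins =
      (L.bind Atom.ins).map (fun n => 2 * n) + (L'.bind Atom.ins).map (fun n => 2 * n + 1) := by
  rw [disjointUnion, Multiset.add_bind, bind_ins_map, bind_ins_map]

theorem bind_outs_disjointUnion (L L' : Multiset (Atom type)) :
    (disjointUnion L L').bind Atom.outs =
      (L.bind Atom.outs).map (fun n => 2 * n) + (L'.bind Atom.outs).map (fun n => 2 * n + 1) := by
  rw [disjointUnion, Multiset.add_bind, bind_outs_map, bind_outs_map]

theorem nodup_even_odd {s s' : Multiset ℕ} (hs : s.Nodup) (hs' : s'.Nodup) :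
    (s.map (fun n => 2 * n) + s'.map (fun n => 2 * n + 1)).Nodup := by
  rw [Multiset.nodup_add]
  refine ⟨hs.map double_injective, hs'.map double_succ_injective, ?_⟩
  rw [Multiset.disjoint_left]
  intro a ha hb
  simp only [Multiset.mem_map] at ha hb
  obtain ⟨m, -, rfl⟩ := ha
  obtain ⟨n, -, h⟩ := hb
  omega

theorem even_mem {s s' : Multiset ℕ} {n : ℕ} :
    2 * n ∈ s.map (fun n => 2 * n) + s'.map (fun n => 2 * n + 1) ↔ n ∈ s := by
  simp only [Multiset.mem_add, Multiset.mem_map]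
  constructor
  · rintro (⟨a, ha, h⟩ | ⟨a, ha, h⟩)
    · obtain rfl : a = n := by omega
      exact ha
    · omega
  · exact fun h => Or.inl ⟨n, h, rfl⟩

theorem odd_mem {s s' : Multiset ℕ} {n : ℕ} :
    2 * n + 1 ∈ s.map (fun n => 2 * n) + s'.map (fun n => 2 * n + 1) ↔ n ∈ s' := by
  simp only [Multiset.mem_add, Multiset.mem_map]
  constructor
  · rintro (⟨a, ha, h⟩ | ⟨a, ha, h⟩)
    · omega
    · obtain rfl : a = n := by omega
      exact ha
  · exact fun h => Or.inr ⟨n, h, rfl⟩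

/-- Concatenation of two families of variables, renamed apart. -/
def joinVars {m n : ℕ} (x : Fin m → ℕ) (y : Fin n → ℕ) : Fin (m + n) → ℕ :=
  Fin.append (fun i => 2 * x i) (fun i => 2 * y i + 1)

theorem joinVars_injective {m n : ℕ} {x : Fin m → ℕ} {y : Fin n → ℕ}
    (hx : Function.Injective x) (hy : Function.Injective y) :
    Function.Injective (joinVars x y) := by
  intro a b
  refine Fin.addCases (fun i => ?_) (fun i => ?_) a <;>
    refine Fin.addCases (fun j => ?_) (fun j => ?_) b <;>
    simp only [joinVars, Fin.append_left, Fin.append_right] <;> intro h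
  · rw [hx (show x i = x j by omega)]
  · omega
  · omega
  · rw [hy (show y i = y j by omega)]

theorem mem_range_joinVars {m n : ℕ} {x : Fin m → ℕ} {y : Fin n → ℕ} (z : ℕ) :
    z ∈ Set.range (joinVars x y) ↔ (∃ i, 2 * x i = z) ∨ (∃ i, 2 * y i + 1 = z) := by
  constructor
  · rintro ⟨a, rfl⟩
    refine Fin.addCases (fun i => ?_) (fun i => ?_) a
    · exact Or.inl ⟨i, by simp [joinVars]⟩
    · exact Or.inr ⟨i, by simp [joinVars]⟩
  · rintro (⟨i, rfl⟩ | ⟨i, rfl⟩)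
    · exact ⟨Fin.castAdd n i, by simp [joinVars]⟩
    · exact ⟨Fin.natAdd m i, by simp [joinVars]⟩

theorem range_joinVars {m n : ℕ} {x : Fin m → ℕ} {y : Fin n → ℕ} {s t s' t' : Multiset ℕ}
    (hx : ∀ z, (∃ k, x k = z) ↔ z ∈ s ∧ z ∉ t) (hy : ∀ z, (∃ k, y k = z) ↔ z ∈ s' ∧ z ∉ t')
    (z : ℕ) :
    z ∈ Set.range (joinVars x y) ↔
      z ∈ s.map (fun n => 2 * n) + s'.map (fun n => 2 * n + 1) ∧
        z ∉ t.map (fun n => 2 * n) + t'.map (fun n => 2 * n + 1) := by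
  rw [mem_range_joinVars]
  obtain ⟨c, rfl | rfl⟩ : ∃ c, z = 2 * c ∨ z = 2 * c + 1 := ⟨z / 2, by omega⟩
  · rw [even_mem, even_mem, ← hx]
    constructor
    · rintro (⟨i, h⟩ | ⟨i, h⟩)
      · exact ⟨i, by omega⟩
      · omega
    · rintro ⟨i, h⟩
      exact Or.inl ⟨i, by omega⟩
  · rw [odd_mem, odd_mem, ← hy]
    constructor
    · rintro (⟨i, h⟩ | ⟨i, h⟩)
      · omega
      · exact ⟨i, by omega⟩
    · rintro ⟨i, h⟩
      exact Or.inr ⟨i, by omega⟩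

/-- Juxtaposition: rename the variables apart, take all atoms of `M` and of `N`, and put the free
variables of `M` before those of `N`. -/
def tensor (M : OrderedMolecule type p₁ q₁) (N : OrderedMolecule type p₂ q₂) :
    OrderedMolecule type (p₁ + p₂) (q₁ + q₂) where
  atoms := disjointUnion M.atoms N.atoms
  nodup_ins := by
    rw [bind_ins_disjointUnion]
    exact nodup_even_odd M.nodup_ins N.nodup_ins
  nodup_outs := by
    rw [bind_outs_disjointUnion]
    exact nodup_even_odd M.nodup_outs N.nodup_outs
  inp := joinVars M.inp N.inp
  out := joinVars M.out N.out
  inp_injective := joinVars_injective M.inp_injective N.inp_injective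
  out_injective := joinVars_injective M.out_injective N.out_injective
  range_inp := by
    ext z
    simp only [Molecule.inputVars, Set.mem_ofPred_eq, bind_ins_disjointUnion,
      bind_outs_disjointUnion]
    exact range_joinVars M.mem_range_inp N.mem_range_inp z
  range_out := by
    ext z
    simp only [Molecule.outputVars, Set.mem_ofPred_eq, bind_ins_disjointUnion,
      bind_outs_disjointUnion]
    exact range_joinVars M.mem_range_out N.mem_range_out z

/-- The substitution replacing the variable `y` by the variable `x`. -/
def subst (x y : ℕ) : ℕ → ℕ := Function.update id y x

theorem subst_self (x y : ℕ) : subst x y y = x := by simp [subst]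

theorem subst_of_ne (x : ℕ) {y z : ℕ} (h : z ≠ y) : subst x y z = z := by simp [subst, h]

theorem inp_mem (M : OrderedMolecule type p q) (i : Fin p) :
    M.inp i ∈ M.atoms.bind Atom.ins ∧ M.inp i ∉ M.atoms.bind Atom.outs :=
  (M.mem_range_inp _).1 ⟨i, rfl⟩

theorem out_mem (M : OrderedMolecule type p q) (j : Fin q) :
    M.out j ∈ M.atoms.bind Atom.outs ∧ M.out j ∉ M.atoms.bind Atom.ins :=
  (M.mem_range_out _).1 ⟨j, rfl⟩

/-- `z` remains a lower index after `y` is replaced by `x`. -/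
theorem mem_map_subst {s : Multiset ℕ} {x y z : ℕ} (hy : y ∈ s) :
    z ∈ s.map (subst x y) ↔ z = x ∨ (z ∈ s ∧ z ≠ y) := by
  rw [Multiset.mem_map]
  constructor
  · rintro ⟨a, ha, rfl⟩
    by_cases h : a = y
    · subst h
      exact Or.inl (subst_self _ _)
    · rw [subst_of_ne x h]
      exact Or.inr ⟨ha, h⟩
  · rintro (rfl | ⟨h, h'⟩)
    · exact ⟨y, hy, subst_self _ _⟩
    · exact ⟨z, h, subst_of_ne x h'⟩

/-- Contraction: replace the output variable number `j` by the input variable number `i`, and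
remove both from the orderings. -/
def contr (i : Fin (p + 1)) (j : Fin (q + 1)) (M : OrderedMolecule type (p + 1) (q + 1)) :
    OrderedMolecule type p q where
  atoms := M.atoms.map (Atom.map id (subst (M.inp i) (M.out j)))
  nodup_ins := by
    rw [bind_ins_map, Multiset.map_id]
    exact M.nodup_ins
  nodup_outs := by
    rw [bind_outs_map]
    refine Multiset.Nodup.map_on ?_ M.nodup_outs
    intro a ha b hb h
    have hi := (M.inp_mem i).2
    by_cases h1 : a = M.out j <;> by_cases h2 : b = M.out j
    · rw [h1, h2]
    · rw [h1, subst_self, subst_of_ne _ h2] at h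
      exact absurd (h ▸ hb) hi
    · rw [h2, subst_self, subst_of_ne _ h1] at h
      exact absurd (h ▸ ha) hi
    · rwa [subst_of_ne _ h1, subst_of_ne _ h2] at h
  inp := M.inp ∘ i.succAbove
  out := M.out ∘ j.succAbove
  inp_injective := M.inp_injective.comp Fin.succAbove_right_injective
  out_injective := M.out_injective.comp Fin.succAbove_right_injective
  range_inp := by
    ext z
    simp only [Molecule.inputVars, Set.mem_ofPred_eq, bind_ins_map, bind_outs_map, Multiset.map_id,
      mem_map_subst (M.out_mem j).1, Set.mem_range, Function.comp_apply]
    constructor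
    · rintro ⟨k, rfl⟩
      have h := M.inp_mem (i.succAbove k)
      refine ⟨h.1, ?_⟩
      rintro (h' | h')
      · exact Fin.succAbove_ne i k (M.inp_injective h')
      · exact h.2 h'.1
    · rintro ⟨h1, h2⟩
      push Not at h2
      have hz : z ∉ M.atoms.bind Atom.outs := fun h =>
        (M.out_mem j).2 (h2.2 h ▸ h1)
      obtain ⟨k, rfl⟩ := (M.mem_range_inp z).2 ⟨h1, hz⟩
      obtain ⟨l, rfl⟩ := Fin.exists_succAbove_eq (fun h : k = i => h2.1 (congrArg _ h))
      exact ⟨l, rfl⟩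
  range_out := by
    ext z
    simp only [Molecule.outputVars, Set.mem_ofPred_eq, bind_ins_map, bind_outs_map, Multiset.map_id,
      mem_map_subst (M.out_mem j).1, Set.mem_range, Function.comp_apply]
    constructor
    · rintro ⟨k, rfl⟩
      have h := M.out_mem (j.succAbove k)
      exact ⟨Or.inr ⟨h.1, fun h' => Fin.succAbove_ne j k (M.out_injective h')⟩, h.2⟩
    · rintro ⟨rfl | ⟨h1, h3⟩, h2⟩
      · exact absurd (M.inp_mem i).1 h2
      · obtain ⟨k, rfl⟩ := (M.mem_range_out z).2 ⟨h1, h2⟩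
        obtain ⟨l, rfl⟩ := Fin.exists_succAbove_eq (fun h : k = j => h3 (congrArg _ h))
        exact ⟨l, rfl⟩

/-- A permutation of the even and one of the odd numbers. -/
def evenOddPerm (σ τ : Equiv.Perm ℕ) : Equiv.Perm ℕ :=
  Equiv.natSumNatEquivNat.permCongr (Equiv.sumCongr σ τ)

theorem evenOddPerm_even (σ τ : Equiv.Perm ℕ) (n : ℕ) : evenOddPerm σ τ (2 * n) = 2 * σ n := by
  have h : Equiv.natSumNatEquivNat.symm (2 * n) = Sum.inl n := by
    rw [Equiv.symm_apply_eq]; simp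
  simp [evenOddPerm, Equiv.permCongr_apply, h]

theorem evenOddPerm_odd (σ τ : Equiv.Perm ℕ) (n : ℕ) :
    evenOddPerm σ τ (2 * n + 1) = 2 * τ n + 1 := by
  have h : Equiv.natSumNatEquivNat.symm (2 * n + 1) = Sum.inr n := by
    rw [Equiv.symm_apply_eq]; simp
  simp [evenOddPerm, Equiv.permCongr_apply, h]

theorem comp_joinVars {m n : ℕ} (σ τ : Equiv.Perm ℕ) (x : Fin m → ℕ) (y : Fin n → ℕ) :
    evenOddPerm σ τ ∘ joinVars x y = joinVars (σ ∘ x) (τ ∘ y) := by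
  ext a
  refine Fin.addCases (fun i => ?_) (fun i => ?_) a <;>
    simp [joinVars, evenOddPerm_even, evenOddPerm_odd]

theorem map_disjointUnion (σ τ : Equiv.Perm ℕ) (L L' : Multiset (Atom type)) :
    (disjointUnion L L').map (Atom.map (evenOddPerm σ τ) (evenOddPerm σ τ)) =
      disjointUnion (L.map (Atom.map σ σ)) (L'.map (Atom.map τ τ)) := by
  have h1 : ⇑(evenOddPerm σ τ) ∘ (fun n => 2 * n) = (fun n => 2 * n) ∘ σ :=
    funext fun n => evenOddPerm_even σ τ n
  have h2 : ⇑(evenOddPerm σ τ) ∘ (fun n => 2 * n + 1) = (fun n => 2 * n + 1) ∘ τ :=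
    funext fun n => evenOddPerm_odd σ τ n
  simp only [disjointUnion, Multiset.map_add, Multiset.map_map]
  congr 1 <;> refine Multiset.map_congr rfl fun a _ => ?_ <;>
    simp only [Function.comp_apply, Atom.map_map, h1, h2]

theorem atoms_one_map_id (L : Multiset (Atom type)) :
    L.map (Atom.map ⇑(1 : Equiv.Perm ℕ) ⇑(1 : Equiv.Perm ℕ)) = L := by
  have : (Atom.map ⇑(1 : Equiv.Perm ℕ) ⇑(1 : Equiv.Perm ℕ) : Atom type → Atom type) = id := by
    funext a
    cases a <;> rfl
  rw [this, Multiset.map_id]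

theorem Move.tensor_left {M M' : OrderedMolecule type p₁ q₁} (h : Move M M')
    (N : OrderedMolecule type p₂ q₂) : Move (M.tensor N) (M'.tensor N) := by
  cases h with
  | arrow_arrow x y z L hM hN hinp hout =>
    refine .arrow_arrow _ _ (2 * x) (2 * y) (2 * z) (disjointUnion L N.atoms) ?_ ?_ ?_ ?_ <;>
      simp [tensor, disjointUnion, hM, hN, hinp, hout, Atom.map]
  | gen_out A x y i z L hM hN hinp hout =>
    refine .gen_out _ _ A (fun k => 2 * x k) (fun k => 2 * y k) i (2 * z)
      (disjointUnion L N.atoms) ?_ ?_ ?_ ?_ <;>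
      simp [tensor, disjointUnion, hM, hN, hinp, hout, Atom.map, Function.comp_update] <;>
      exact ⟨rfl, rfl⟩
  | gen_in A x y i z L hM hN hinp hout =>
    refine .gen_in _ _ A (fun k => 2 * x k) (fun k => 2 * y k) i (2 * z)
      (disjointUnion L N.atoms) ?_ ?_ ?_ ?_ <;>
      simp [tensor, disjointUnion, hM, hN, hinp, hout, Atom.map, Function.comp_update] <;>
      exact ⟨rfl, rfl⟩
  | rename σ hN hinp hout =>
    refine .rename _ _ (evenOddPerm σ 1) ?_ ?_ ?_
    · simp only [tensor, map_disjointUnion, hN, atoms_one_map_id]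
    · simp only [tensor, comp_joinVars, hinp]; rfl
    · simp only [tensor, comp_joinVars, hout]; rfl

theorem Move.tensor_right (M : OrderedMolecule type p₁ q₁) {N N' : OrderedMolecule type p₂ q₂}
    (h : Move N N') : Move (M.tensor N) (M.tensor N') := by
  cases h with
  | arrow_arrow x y z L hM hN hinp hout =>
    refine .arrow_arrow _ _ (2 * x + 1) (2 * y + 1) (2 * z + 1) (disjointUnion M.atoms L)
      ?_ ?_ ?_ ?_ <;>
      simp [tensor, disjointUnion, hM, hN, hinp, hout, Atom.map]
  | gen_out A x y i z L hM hN hinp hout =>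
    refine .gen_out _ _ A (fun k => 2 * x k + 1) (fun k => 2 * y k + 1) i (2 * z + 1)
      (disjointUnion M.atoms L) ?_ ?_ ?_ ?_ <;>
      simp [tensor, disjointUnion, hM, hN, hinp, hout, Atom.map, Function.comp_update] <;>
      exact ⟨rfl, rfl⟩
  | gen_in A x y i z L hM hN hinp hout =>
    refine .gen_in _ _ A (fun k => 2 * x k + 1) (fun k => 2 * y k + 1) i (2 * z + 1)
      (disjointUnion M.atoms L) ?_ ?_ ?_ ?_ <;>
      simp [tensor, disjointUnion, hM, hN, hinp, hout, Atom.map, Function.comp_update] <;>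
      exact ⟨rfl, rfl⟩
  | rename σ hN hinp hout =>
    refine .rename _ _ (evenOddPerm 1 σ) ?_ ?_ ?_
    · simp only [tensor, map_disjointUnion, hN, atoms_one_map_id]
    · simp only [tensor, comp_joinVars, hinp]; rfl
    · simp only [tensor, comp_joinVars, hout]; rfl

theorem Move.contr {M N : OrderedMolecule type (p + 1) (q + 1)} (h : Move M N)
    (i : Fin (p + 1)) (j : Fin (q + 1)) : Move (M.contr i j) (N.contr i j) := by
  have hj := (M.out_mem j).2
  cases h with
  | arrow_arrow x y z L hM hN hinp hout =>
    have hy : y ≠ M.out j := by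
      rintro rfl
      exact hj (by simp [hM, Atom.ins])
    refine .arrow_arrow _ _ x y (subst (M.inp i) (M.out j) z)
      (L.map (Atom.map id (subst (M.inp i) (M.out j)))) ?_ ?_ ?_ ?_ <;>
      simp [OrderedMolecule.contr, hM, hN, hinp, hout, Atom.map, subst_of_ne _ hy]
  | gen_out A x y k z L hM hN hinp hout =>
    have hy : y k ≠ M.out j := by
      intro h
      exact hj (by simp [hM, Atom.ins, ← h])
    refine .gen_out _ _ A x (subst (M.inp i) (M.out j) ∘ y) k (subst (M.inp i) (M.out j) z)
      (L.map (Atom.map id (subst (M.inp i) (M.out j)))) ?_ ?_ ?_ ?_ <;>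
      simp [OrderedMolecule.contr, hM, hN, hinp, hout, Atom.map, subst_of_ne _ hy,
        Function.comp_update]
  | gen_in A x y k z L hM hN hinp hout =>
    have hx : x k ≠ M.out j := by
      intro h
      exact hj (by simp [hM, Atom.ins, ← h])
    refine .gen_in _ _ A x (subst (M.inp i) (M.out j) ∘ y) k z
      (L.map (Atom.map id (subst (M.inp i) (M.out j)))) ?_ ?_ ?_ ?_ <;>
      simp [OrderedMolecule.contr, hM, hN, hinp, hout, Atom.map, subst_of_ne _ hx]
  | rename σ hN hinp hout =>
    refine .rename _ _ σ ?_ ?_ ?_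
    · have h : subst (σ (M.inp i)) (σ (M.out j)) ∘ σ = σ ∘ subst (M.inp i) (M.out j) := by
        funext n
        by_cases hn : n = M.out j
        · subst hn
          simp [subst_self]
        · simp [subst_of_ne _ hn, subst_of_ne _ (σ.injective.ne hn)]
      simp only [OrderedMolecule.contr, hN, hinp, hout, Multiset.map_map, Function.comp_def,
        Atom.map_map]
      simp only [← Function.comp_def, h]
      rfl
    · simp only [OrderedMolecule.contr, hinp]; rfl
    · simp only [OrderedMolecule.contr, hout]; rfl

end OrderedMolecule

/-! ### Monomials and free wheeled PROPs -/

/-- Monomials with `p` inputs and `q` outputs: molecules with ordered free variables, up to the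
equivalence relation generated by the moves. -/
def Monomial {G : Type v} (type : G → ℕ × ℕ) (p q : ℕ) : Type v :=
  Quot (OrderedMolecule.Move (type := type) (p := p) (q := q))

namespace Monomial

variable {G : Type v} {type : G → ℕ × ℕ} {p q p₁ q₁ p₂ q₂ : ℕ}

/-- The class of a molecule with ordered free variables. -/
def mk (M : OrderedMolecule type p q) : Monomial type p q := Quot.mk _ M

/-- The product of monomials: `M` to the left of `N`. -/
def tensor : Monomial type p₁ q₁ → Monomial type p₂ q₂ → Monomial type (p₁ + p₂) (q₁ + q₂) :=
  Quot.map₂ OrderedMolecule.tensor (fun M _ _ h => h.tensor_right M) (fun _ _ N h => h.tensor_left N)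

/-- Connecting the output number `j` to the input number `i`. -/
def contr (i : Fin (p + 1)) (j : Fin (q + 1)) : Monomial type (p + 1) (q + 1) → Monomial type p q :=
  Quot.map (OrderedMolecule.contr i j) (fun _ _ h => h.contr i j)

end Monomial

/-- The free wheeled PROP on the generators `G` with the given types: the component of bidegree
`(p, q)` is the vector space with basis the monomials with `p` inputs and `q` outputs. -/
noncomputable def FreeWheeledPROP (K : Type u) [Field K] {G : Type v} (type : G → ℕ × ℕ) :
    PreWheeledPROP.{u, max u v} K where
  obj p q := Monomial type p q →₀ K
  one := Finsupp.single (Monomial.mk OrderedMolecule.empty) 1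
  idn := Finsupp.single (Monomial.mk OrderedMolecule.arrow) 1
  tensor {_ _ _ _} := Finsupp.lift _ K _ fun m => Finsupp.lmapDomain K K (Monomial.tensor m)
  contr i j := Finsupp.lmapDomain K K (Monomial.contr i j)

/-- A generator, viewed as a monomial in the free wheeled PROP. -/
noncomputable def FreeWheeledPROP.of (K : Type u) [Field K] {G : Type v} (type : G → ℕ × ℕ)
    (A : G) : (FreeWheeledPROP K type).obj (type A).1 (type A).2 :=
  (Finsupp.single (Monomial.mk (OrderedMolecule.gen A)) 1 :
    Monomial type (type A).1 (type A).2 →₀ K)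

/-- A wheeled PROP is a pre-wheeled PROP that admits a surjective homomorphism from a free wheeled
PROP; a homomorphism of wheeled PROPs is a homomorphism of pre-wheeled PROPs. -/
def PreWheeledPROP.IsWheeledPROP {K : Type u} [Field K] (R : PreWheeledPROP.{u, t} K) : Prop :=
  ∃ (H : Type w) (type : H → ℕ × ℕ) (π : (FreeWheeledPROP K type).Hom R), π.IsSurjective

/-- The free wheeled PROP is a wheeled PROP. -/
theorem FreeWheeledPROP.isWheeledPROP (K : Type u) [Field K] {G : Type v} (type : G → ℕ × ℕ) :
    PreWheeledPROP.IsWheeledPROP.{u, v} (FreeWheeledPROP K type) :=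
  ⟨G, type, ⟨fun _ _ => LinearMap.id, rfl, rfl, fun _ _ => rfl, fun _ _ _ => rfl⟩,
    fun _ _ => Function.surjective_id⟩

/-! Existence. Lift each `ψ A` along the surjection `π` from a free wheeled PROP on `H` to a linear
combination `ψ' A` of monomials. It then suffices to build a homomorphism of free wheeled PROPs
sending `A` to `ψ' A` (`FreeWheeledPROP.substHom`) and to compose it with `π`. This reduction avoids
deriving any axioms for the target: all verifications take place among molecules.

That homomorphism is substitution. A product of atoms is expanded multilinearly into products of
decorated generators, a decoration being one monomial of `ψ' A`. Each decorated generator is then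
replaced by a representative of its decoration, whose free variables take the names of the indices
of the generator and whose bound variables take fresh names. Substitution is possible by
`OrderedMolecule.exists_isSubst`, and its outcome depends on the fresh names only up to renaming
(`IsSubst.mk_eq`). By `Move.absorb_or_rename` every move either absorbs an arrow into an adjacent
atom or renames variables. Substitution leaves arrows in place and commutes with changes of indices
(`IsSubst.map`), so it respects the moves, tensor products and contractions.

Uniqueness. Every monomial arises from the unit, the identity and the generators by tensor products
and contractions (`Monomial.IsClosed.of_monomial`). Cutting a bound variable exhibits a molecule as
a contraction of one with fewer bound variables. Without bound variables, a molecule is a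
juxtaposition of its atoms up to the orderings of the free variables. Any ordering is reached by
composing with arrows, since tensoring with an arrow and contracting moves one free variable to the
last place. -/

/-! ### Changing the indices of atoms and molecules -/

namespace Atom

variable {G : Type v} {type : G → ℕ × ℕ}

theorem map_congr {f g f' g' : ℕ → ℕ} (a : Atom type) (hf : ∀ v ∈ a.ins, f v = f' v)
    (hg : ∀ v ∈ a.outs, g v = g' v) : a.map f g = a.map f' g' := by
  cases a with
  | gen A x y =>
    simp only [map, gen.injEq, heq_eq_eq, true_and]
    constructor <;> funext i
    · exact hf _ (by simp [ins])
    · exact hg _ (by simp [outs])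
  | arrow x y =>
    simp only [map, arrow.injEq]
    exact ⟨hf _ (by simp [ins]), hg _ (by simp [outs])⟩

theorem map_id_id (a : Atom type) : a.map id id = a := by cases a <;> rfl

end Atom

namespace Multiset

variable {G : Type v} {type : G → ℕ × ℕ}

theorem map_atoms_congr {f g f' g' : ℕ → ℕ} (L : Multiset (Atom type))
    (hf : ∀ v ∈ L.bind Atom.ins, f v = f' v) (hg : ∀ v ∈ L.bind Atom.outs, g v = g' v) :
    L.map (Atom.map f g) = L.map (Atom.map f' g') :=
  map_congr rfl fun a ha => a.map_congr
    (fun v hv => hf v (mem_bind.2 ⟨a, ha, hv⟩)) fun v hv => hg v (mem_bind.2 ⟨a, ha, hv⟩)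

theorem map_atoms_eq_self {f g : ℕ → ℕ} (L : Multiset (Atom type))
    (hf : ∀ v ∈ L.bind Atom.ins, f v = v) (hg : ∀ v ∈ L.bind Atom.outs, g v = v) :
    L.map (Atom.map f g) = L := by
  rw [L.map_atoms_congr (f' := id) (g' := id) hf hg]
  simp [Atom.map_id_id]

theorem map_atoms_map (f g f' g' : ℕ → ℕ) (L : Multiset (Atom type)) :
    (L.map (Atom.map f g)).map (Atom.map f' g') = L.map (Atom.map (f' ∘ f) (g' ∘ g)) := by
  simp [Function.comp_def, Atom.map_map]

/-- Variables occurring in both of two multisets may be added or removed simultaneously without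
changing which variables occur in the first only. -/
theorem mem_add_and_not_mem_iff {s t B : Multiset ℕ} (h : (s + B).Nodup) (z : ℕ) :
    (z ∈ s + B ∧ z ∉ t + B) ↔ (z ∈ s ∧ z ∉ t) := by
  have : z ∈ s → z ∉ B := fun hz => Multiset.disjoint_left.1 (Multiset.nodup_add.1 h).2.2 hz
  simp only [mem_add]
  tauto

end Multiset

/-- An injection defined on a finite set of natural numbers extends to a permutation. -/
theorem Finset.exists_perm_extending (S : Finset ℕ) (f : ℕ → ℕ) (hf : Set.InjOn f S) :
    ∃ σ : Equiv.Perm ℕ, ∀ v ∈ S, σ v = f v := by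
  -- A partial injection extends to a bijection because its domain has smaller cardinality than `ℕ`.
  obtain ⟨g, hg⟩ := Cardinal.extend_function_of_lt (s := (S : Set ℕ))
    ⟨fun v => f v, fun a b h => Subtype.ext (hf a.2 b.2 h)⟩
    (by simp) ⟨Equiv.refl ℕ⟩
  exact ⟨g, fun v hv => hg ⟨v, hv⟩⟩

namespace OrderedMolecule

variable {G : Type v} {type : G → ℕ × ℕ} {H : Type w} {typeH : H → ℕ × ℕ} {p q : ℕ}

theorem ext_of {M N : OrderedMolecule type p q} (h : M.atoms = N.atoms) (hi : M.inp = N.inp)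
    (ho : M.out = N.out) : M = N := by
  obtain ⟨⟨⟩⟩ := M
  obtain ⟨⟨⟩⟩ := N
  subst h hi ho
  rfl

theorem exists_mk (L : Multiset (Atom type)) (inp : Fin p → ℕ) (out : Fin q → ℕ)
    (ni : (L.bind Atom.ins).Nodup) (no : (L.bind Atom.outs).Nodup)
    (hi : Function.Injective inp) (ho : Function.Injective out)
    (ri : ∀ z, (∃ k, inp k = z) ↔ z ∈ L.bind Atom.ins ∧ z ∉ L.bind Atom.outs)
    (ro : ∀ z, (∃ k, out k = z) ↔ z ∈ L.bind Atom.outs ∧ z ∉ L.bind Atom.ins) :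
    ∃ M : OrderedMolecule type p q, M.atoms = L ∧ M.inp = inp ∧ M.out = out :=
  ⟨⟨⟨L, ni, no⟩, inp, out, hi, ho, Set.ext ri, Set.ext ro⟩, rfl, rfl, rfl⟩

/-- Atoms with the same variables as those of `M`, up to additional bound variables, form a
molecule with the same free variables. -/
theorem exists_of_add_bound (M : OrderedMolecule type p q) (L : Multiset (Atom typeH))
    (B : Multiset ℕ) (hi : L.bind Atom.ins = M.atoms.bind Atom.ins + B)
    (ho : L.bind Atom.outs = M.atoms.bind Atom.outs + B)
    (ni : (L.bind Atom.ins).Nodup) (no : (L.bind Atom.outs).Nodup) :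
    ∃ N : OrderedMolecule typeH p q, N.atoms = L ∧ N.inp = M.inp ∧ N.out = M.out := by
  refine exists_mk L M.inp M.out ni no M.inp_injective M.out_injective (fun z => ?_) fun z => ?_
  · rw [M.mem_range_inp, hi, ho, Multiset.mem_add_and_not_mem_iff (hi ▸ ni)]
  · rw [M.mem_range_out, hi, ho, Multiset.mem_add_and_not_mem_iff (ho ▸ no)]

/-- Atoms with the same variables as those of `M`, with some bound variables left out, form a
molecule with the same free variables. -/
theorem exists_of_remove_bound (M : OrderedMolecule type p q) (L : Multiset (Atom typeH))
    (B : Multiset ℕ) (hi : M.atoms.bind Atom.ins = L.bind Atom.ins + B)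
    (ho : M.atoms.bind Atom.outs = L.bind Atom.outs + B) :
    ∃ N : OrderedMolecule typeH p q, N.atoms = L ∧ N.inp = M.inp ∧ N.out = M.out := by
  have ni := M.nodup_ins
  have no := M.nodup_outs
  rw [hi] at ni
  rw [ho] at no
  refine exists_mk L M.inp M.out (Multiset.nodup_add.1 ni).1 (Multiset.nodup_add.1 no).1
    M.inp_injective M.out_injective (fun z => ?_) fun z => ?_
  · rw [M.mem_range_inp, hi, ho, Multiset.mem_add_and_not_mem_iff ni]
  · rw [M.mem_range_out, hi, ho, Multiset.mem_add_and_not_mem_iff no]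

theorem exists_rename (M : OrderedMolecule type p q) (σ : Equiv.Perm ℕ) :
    ∃ N : OrderedMolecule type p q, N.atoms = M.atoms.map (Atom.map σ σ) ∧ N.inp = σ ∘ M.inp ∧
      N.out = σ ∘ M.out := by
  refine exists_mk _ _ _ ?_ ?_ (σ.injective.comp M.inp_injective)
    (σ.injective.comp M.out_injective) (fun z => ?_) fun z => ?_
  · rw [bind_ins_map]
    exact M.nodup_ins.map σ.injective
  · rw [bind_outs_map]
    exact M.nodup_outs.map σ.injective
  all_goals
    obtain ⟨z, rfl⟩ := σ.surjective z
    simp only [bind_ins_map, bind_outs_map, Function.comp_apply, EmbeddingLike.apply_eq_iff_eq,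
      Multiset.mem_map_of_injective σ.injective]
  · exact M.mem_range_inp z
  · exact M.mem_range_out z

theorem mk_eq_of_atoms {M N : OrderedMolecule type p q} (h : N.atoms = M.atoms)
    (hi : N.inp = M.inp) (ho : N.out = M.out) : Monomial.mk M = Monomial.mk N := by
  rw [ext_of h hi ho]

/-- Renaming the variables injectively does not change the monomial. -/
theorem mk_eq_of_map {M N : OrderedMolecule type p q} (f : ℕ → ℕ)
    (hf : ∀ a b, (a ∈ M.atoms.bind Atom.ins ∨ a ∈ M.atoms.bind Atom.outs) →
      (b ∈ M.atoms.bind Atom.ins ∨ b ∈ M.atoms.bind Atom.outs) → f a = f b → a = b)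
    (hN : N.atoms = M.atoms.map (Atom.map f f)) (hi : N.inp = f ∘ M.inp)
    (ho : N.out = f ∘ M.out) : Monomial.mk M = Monomial.mk N := by
  -- Renaming moves require a permutation of all variables, but only the values of `f` on the
  -- finitely many occurring variables matter, so `f` itself need not be bijective.
  obtain ⟨σ, hσ⟩ := Finset.exists_perm_extending
    ((M.atoms.bind Atom.ins).toFinset ∪ (M.atoms.bind Atom.outs).toFinset) f
    (fun a ha b hb => hf a b (by simpa using ha) (by simpa using hb))
  simp only [Finset.mem_union, Multiset.mem_toFinset] at hσ
  refine Quot.sound (.rename M N σ ?_ ?_ ?_)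
  · rw [hN]
    exact Multiset.map_atoms_congr _ (fun v hv => (hσ v (.inl hv)).symm)
      fun v hv => (hσ v (.inr hv)).symm
  · rw [hi]
    funext k
    exact (hσ _ (.inl (M.inp_mem k).1)).symm
  · rw [ho]
    funext k
    exact (hσ _ (.inr (M.out_mem k).1)).symm

theorem subst_map_eq_self {s : Multiset ℕ} {x y : ℕ} (h : y ∉ s) : s.map (subst x y) = s := by
  conv_rhs => rw [← Multiset.map_id s]
  exact Multiset.map_congr rfl fun v hv => subst_of_ne x (fun e => h (e ▸ hv))

theorem map_subst_of_cons {s t : Multiset ℕ} {x y : ℕ} (h : s = y ::ₘ t) (hs : s.Nodup) :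
    s.map (subst x y) = x ::ₘ t := by
  subst h
  rw [Multiset.map_cons, subst_self, subst_map_eq_self (Multiset.nodup_cons.1 hs).1]

theorem comp_subst_eq_update {n : ℕ} {x : Fin n → ℕ} (hx : Function.Injective x) (i : Fin n)
    (z : ℕ) : subst z (x i) ∘ x = Function.update x i z := by
  funext k
  by_cases h : k = i
  · subst h
    simp [subst_self]
  · simp [h, subst_of_ne _ (hx.ne h)]

theorem map_subst_out_eq_self {L : Multiset (Atom type)} {w : ℕ} (z : ℕ)
    (h : w ∉ L.bind Atom.outs) : L.map (Atom.map id (subst z w)) = L :=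
  L.map_atoms_eq_self (fun _ _ => rfl) fun _ hv => subst_of_ne _ (ne_of_mem_of_not_mem hv h)

theorem map_subst_in_eq_self {L : Multiset (Atom type)} {w : ℕ} (z : ℕ)
    (h : w ∉ L.bind Atom.ins) : L.map (Atom.map (subst z w) id) = L :=
  L.map_atoms_eq_self (fun _ hv => subst_of_ne _ (ne_of_mem_of_not_mem hv h)) fun _ _ => rfl

theorem injective_of_nodup_map {n : ℕ} {x : Fin n → ℕ}
    (h : (Finset.univ.val.map x).Nodup) : Function.Injective x :=
  fun a b e => Multiset.inj_on_of_nodup_map h a (by simp) b (by simp) e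

theorem cons_notMem {L : Multiset (Atom type)} {a : Atom type} {f : Atom type → Multiset ℕ}
    (h : ((a ::ₘ L).bind f).Nodup) {v : ℕ} (hv : v ∈ f a) : v ∉ L.bind f := by
  rw [Multiset.cons_bind, Multiset.nodup_add] at h
  exact Multiset.disjoint_left.1 h.2.2 hv

/-- Removing an arrow composed with an output of other atoms. -/
theorem exists_absorb_out (M : OrderedMolecule type p q) (w z : ℕ) (L : Multiset (Atom type))
    (hM : M.atoms = Atom.arrow w z ::ₘ L) (hw : w ∈ L.bind Atom.outs) :
    ∃ N : OrderedMolecule type p q, N.atoms = L.map (Atom.map id (subst z w)) ∧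
      N.inp = M.inp ∧ N.out = M.out ∧ Monomial.mk M = Monomial.mk N := by
  have ni := M.nodup_ins
  have no := M.nodup_outs
  rw [hM] at ni no
  have no' : (L.bind Atom.outs).Nodup := by
    rw [Multiset.cons_bind, Multiset.nodup_add] at no
    exact no.2.1
  obtain ⟨t, ht⟩ := Multiset.exists_cons_of_mem hw
  -- The variable `w` is bound: it is the upper index of the arrow and a lower index in `L`.
  -- Absorbing the arrow deletes exactly these two occurrences.
  obtain ⟨N, hN, hi, ho⟩ := M.exists_of_remove_bound (L.map (Atom.map id (subst z w))) {w}
    (by rw [bind_ins_map, Multiset.map_id, hM, Multiset.cons_bind, add_comm]; rfl)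
    (by
      rw [bind_outs_map, map_subst_of_cons ht no', hM, Multiset.cons_bind, ht]
      simp only [Atom.outs, Multiset.singleton_add]
      rw [add_comm _ ({w} : Multiset ℕ), Multiset.singleton_add, Multiset.cons_swap])
  refine ⟨N, hN, hi, ho, Quot.sound ?_⟩
  obtain ⟨a, ha, hwa⟩ := Multiset.mem_bind.1 hw
  obtain ⟨L, rfl⟩ := Multiset.exists_cons_of_mem ha
  have hL := cons_notMem no' hwa
  rw [Multiset.map_cons, map_subst_out_eq_self z hL] at hN
  -- The atom carrying `w` as a lower index determines which elementary move applies.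
  cases a with
  | gen A x y =>
    have hy : Function.Injective y := by
      rw [Multiset.cons_bind, Multiset.nodup_add] at no'
      exact injective_of_nodup_map no'.1
    obtain ⟨i, -, rfl⟩ := Multiset.mem_map.1 (show w ∈ Finset.univ.val.map y from hwa)
    refine .gen_out M N A x y i z L hM ?_ hi ho
    rw [hN, Atom.map, comp_subst_eq_update hy]
    rfl
  | arrow x y =>
    obtain rfl : w = y := by simpa [Atom.outs] using hwa
    refine .arrow_arrow M N x w z L (by rw [hM, Multiset.cons_swap]) ?_ hi ho
    rw [hN, Atom.map, subst_self]
    rfl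

/-- Removing an arrow composed with an input of other atoms. -/
theorem exists_absorb_in (M : OrderedMolecule type p q) (w z : ℕ) (L : Multiset (Atom type))
    (hM : M.atoms = Atom.arrow z w ::ₘ L) (hw : w ∈ L.bind Atom.ins) :
    ∃ N : OrderedMolecule type p q, N.atoms = L.map (Atom.map (subst z w) id) ∧
      N.inp = M.inp ∧ N.out = M.out ∧ Monomial.mk M = Monomial.mk N := by
  have ni := M.nodup_ins
  have no := M.nodup_outs
  rw [hM] at ni no
  have ni' : (L.bind Atom.ins).Nodup := by
    rw [Multiset.cons_bind, Multiset.nodup_add] at ni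
    exact ni.2.1
  obtain ⟨t, ht⟩ := Multiset.exists_cons_of_mem hw
  obtain ⟨N, hN, hi, ho⟩ := M.exists_of_remove_bound (L.map (Atom.map (subst z w) id)) {w}
    (by
      rw [bind_ins_map, map_subst_of_cons ht ni', hM, Multiset.cons_bind, ht]
      simp only [Atom.ins, Multiset.singleton_add]
      rw [add_comm _ ({w} : Multiset ℕ), Multiset.singleton_add, Multiset.cons_swap])
    (by rw [bind_outs_map, Multiset.map_id, hM, Multiset.cons_bind, add_comm]; rfl)
  refine ⟨N, hN, hi, ho, Quot.sound ?_⟩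
  obtain ⟨a, ha, hwa⟩ := Multiset.mem_bind.1 hw
  obtain ⟨L, rfl⟩ := Multiset.exists_cons_of_mem ha
  have hL := cons_notMem ni' hwa
  rw [Multiset.map_cons, map_subst_in_eq_self z hL] at hN
  cases a with
  | gen A x y =>
    have hx : Function.Injective x := by
      rw [Multiset.cons_bind, Multiset.nodup_add] at ni'
      exact injective_of_nodup_map ni'.1
    obtain ⟨i, -, rfl⟩ := Multiset.mem_map.1 (show w ∈ Finset.univ.val.map x from hwa)
    refine .gen_in M N A x y i z L hM ?_ hi ho
    rw [hN, Atom.map, comp_subst_eq_update hx]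
    rfl
  | arrow x y =>
    obtain rfl : w = x := by simpa [Atom.ins] using hwa
    refine .arrow_arrow M N z w y L hM ?_ hi ho
    rw [hN, Atom.map, subst_self]
    rfl

/-- Every move removes an arrow composed with an output or an input of the other atoms, or renames
the variables. -/
theorem Move.absorb_or_rename {M N : OrderedMolecule type p q} (h : Move M N) :
    (N.inp = M.inp ∧ N.out = M.out ∧ ∃ w z L, M.atoms = Atom.arrow w z ::ₘ L ∧
      w ∈ L.bind Atom.outs ∧ N.atoms = L.map (Atom.map id (subst z w))) ∨
    (N.inp = M.inp ∧ N.out = M.out ∧ ∃ w z L, M.atoms = Atom.arrow z w ::ₘ L ∧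
      w ∈ L.bind Atom.ins ∧ N.atoms = L.map (Atom.map (subst z w) id)) ∨
    ∃ σ : Equiv.Perm ℕ, N.atoms = M.atoms.map (Atom.map σ σ) ∧ N.inp = σ ∘ M.inp ∧
      N.out = σ ∘ M.out := by
  have ni := M.nodup_ins
  have no := M.nodup_outs
  cases h with
  | arrow_arrow x y z L hM hN hinp hout =>
    rw [hM, Multiset.cons_bind, Multiset.nodup_add] at ni
    -- Two composed arrows fit both forms of absorption; here the first arrow is absorbed at the
    -- input of the second.
    refine .inr (.inl ⟨hinp, hout, y, x, _, hM, by simp [Atom.ins], ?_⟩)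
    have hy := cons_notMem ni.2.1 (v := y) (by simp [Atom.ins])
    rw [Multiset.map_cons, Atom.map, subst_self, map_subst_in_eq_self _ hy, hN]
    rfl
  | gen_out A x y i z L hM hN hinp hout =>
    rw [hM] at no
    refine .inl ⟨hinp, hout, y i, z, _, hM, by simp [Atom.outs], ?_⟩
    rw [Multiset.cons_bind, Multiset.nodup_add] at no
    have hy := cons_notMem no.2.1 (v := y i) (by simp [Atom.outs])
    have hy' : Function.Injective y := by
      have := no.2.1
      rw [Multiset.cons_bind, Multiset.nodup_add] at this
      exact injective_of_nodup_map this.1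
    rw [Multiset.map_cons, Atom.map, comp_subst_eq_update hy', map_subst_out_eq_self _ hy, hN]
    rfl
  | gen_in A x y i z L hM hN hinp hout =>
    rw [hM] at ni
    refine .inr (.inl ⟨hinp, hout, x i, z, _, hM, by simp [Atom.ins], ?_⟩)
    rw [Multiset.cons_bind, Multiset.nodup_add] at ni
    have hx := cons_notMem ni.2.1 (v := x i) (by simp [Atom.ins])
    have hx' : Function.Injective x := by
      have := ni.2.1
      rw [Multiset.cons_bind, Multiset.nodup_add] at this
      exact injective_of_nodup_map this.1
    rw [Multiset.map_cons, Atom.map, comp_subst_eq_update hx', map_subst_in_eq_self _ hx, hN]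
    rfl
  | rename σ hN hinp hout => exact .inr (.inr ⟨σ, hN, hinp, hout⟩)

end OrderedMolecule

/-! ### Bound variables -/

namespace OrderedMolecule

variable {G : Type v} {type : G → ℕ × ℕ} {p q : ℕ}

/-- The bound variables of a molecule. -/
def bound (M : OrderedMolecule type p q) : Multiset ℕ :=
  (M.atoms.bind Atom.ins).filter (· ∈ M.atoms.bind Atom.outs)

theorem mem_bound {M : OrderedMolecule type p q} {v : ℕ} :
    v ∈ M.bound ↔ v ∈ M.atoms.bind Atom.ins ∧ v ∈ M.atoms.bind Atom.outs :=
  Multiset.mem_filter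

theorem nodup_bound (M : OrderedMolecule type p q) : M.bound.Nodup := M.nodup_ins.filter _

/-- Upper indices are distinct, so they split into those that are also lower indices and those
listed by `inp`. As an identity of multisets it survives arbitrary, even non-injective, renaming. -/
theorem bind_ins_eq (M : OrderedMolecule type p q) :
    M.atoms.bind Atom.ins = Finset.univ.val.map M.inp + M.bound := by
  rw [add_comm]
  conv_lhs => rw [← Multiset.filter_add_not (· ∈ M.atoms.bind Atom.outs) (M.atoms.bind Atom.ins)]
  congr 1
  refine (Multiset.Nodup.ext (M.nodup_ins.filter _)
    (Finset.univ.nodup.map M.inp_injective)).2 fun v => ?_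
  have := M.mem_range_inp v
  simp only [Multiset.mem_filter, Multiset.mem_map, Finset.mem_val, Finset.mem_univ, true_and, this]

theorem bind_outs_eq (M : OrderedMolecule type p q) :
    M.atoms.bind Atom.outs = Finset.univ.val.map M.out + M.bound := by
  rw [add_comm]
  conv_lhs => rw [← Multiset.filter_add_not (· ∈ M.atoms.bind Atom.ins) (M.atoms.bind Atom.outs)]
  congr 1
  · refine (Multiset.Nodup.ext (M.nodup_outs.filter _) M.nodup_bound).2 fun v => ?_
    rw [mem_bound, Multiset.mem_filter, and_comm]
  · refine (Multiset.Nodup.ext (M.nodup_outs.filter _)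
      (Finset.univ.nodup.map M.out_injective)).2 fun v => ?_
    have := M.mem_range_out v
    simp only [Multiset.mem_filter, Multiset.mem_map, Finset.mem_val, Finset.mem_univ, true_and,
      this]

end OrderedMolecule

/-- Induction on `s`, matching one element at a time. It allows two substitutions into the same
unordered product of atoms to be compared atom by atom. -/
theorem Multiset.exists_pairing {α β γ : Type*} {f : α → γ} {g : β → γ} {s : Multiset α}
    {t : Multiset β} (h : s.map f = t.map g) :
    ∃ P : Multiset (α × β), P.map Prod.fst = s ∧ P.map Prod.snd = t ∧ ∀ p ∈ P, f p.1 = g p.2 := by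
  induction s using Multiset.induction_on generalizing t with
  | empty =>
    obtain rfl : t = 0 := by simpa using h.symm
    exact ⟨0, by simp⟩
  | cons a s ih =>
    rw [map_cons] at h
    obtain ⟨b, hb, e⟩ := mem_map.1 (h ▸ mem_cons_self (f a) _)
    obtain ⟨t, rfl⟩ := exists_cons_of_mem hb
    rw [map_cons, e, cons_inj_right] at h
    obtain ⟨P, rfl, rfl, hP⟩ := ih h
    refine ⟨(a, b) ::ₘ P, by simp, by simp, fun p hp => ?_⟩
    rcases mem_cons.1 hp with rfl | hp
    exacts [e.symm, hP p hp]

/-- A permutation with finitely many prescribed values, fixing the elements of a finite set. -/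
theorem Finset.exists_perm_of_pairs (S : Finset ℕ) (W : Multiset (ℕ × ℕ))
    (n1 : (W.map Prod.fst).Nodup) (n2 : (W.map Prod.snd).Nodup) (d1 : ∀ p ∈ W, p.1 ∉ S)
    (d2 : ∀ p ∈ W, p.2 ∉ S) :
    ∃ σ : Equiv.Perm ℕ, (∀ v ∈ S, σ v = v) ∧ ∀ p ∈ W, σ p.1 = p.2 := by
  classical
  -- The default `v` serves the points of `S`, which by `d1` are never first components; elsewhere
  -- it is irrelevant.
  let f : ℕ → ℕ := fun v => if h : ∃ p ∈ W, p.1 = v then h.choose.2 else v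
  have hW : ∀ p ∈ W, f p.1 = p.2 := fun p hp => by
    have h : ∃ p' ∈ W, p'.1 = p.1 := ⟨p, hp, rfl⟩
    have e := Multiset.inj_on_of_nodup_map n1 _ h.choose_spec.1 _ hp h.choose_spec.2
    simp only [f, dif_pos h, e]
  have hS : ∀ v ∈ S, f v = v := fun v hv => dif_neg fun ⟨p, hp, e⟩ => d1 p hp (e ▸ hv)
  obtain ⟨σ, hσ⟩ := Finset.exists_perm_extending (S ∪ (W.map Prod.fst).toFinset) f (by
    intro a ha b hb e
    simp only [coe_union, Set.mem_union, mem_coe, Multiset.mem_toFinset, Multiset.mem_map] at ha hb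
    rcases ha with ha | ⟨x, hx, rfl⟩ <;> rcases hb with hb | ⟨y, hy, rfl⟩
    · rwa [hS a ha, hS b hb] at e
    · rw [hS a ha, hW y hy] at e
      exact absurd (e ▸ ha) (d2 y hy)
    · rw [hS b hb, hW x hx] at e
      exact absurd (e ▸ hb) (d2 x hx)
    · rw [hW x hx, hW y hy] at e
      rw [Multiset.inj_on_of_nodup_map n2 x hx y hy e])
  refine ⟨σ, fun v hv => ?_, fun p hp => ?_⟩
  · rw [hσ v (mem_union_left _ hv), hS v hv]
  · rw [hσ _ (mem_union_right _ (Multiset.mem_toFinset.2 (Multiset.mem_map_of_mem _ hp))), hW p hp]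

/-! ### Substitution for a single atom -/

/-- An atom together with a way of naming the variables of the molecule to be substituted for its
generator. -/
inductive SubstAtom (G : Type v) : Type v
  | gen (B : G) (f : ℕ → ℕ) : SubstAtom G
  | arrow (x y : ℕ) : SubstAtom G

namespace SubstAtom

variable {G : Type v} {type : G → ℕ × ℕ} {H : Type w} {typeH : H → ℕ × ℕ}
  (rep : ∀ B : G, OrderedMolecule typeH (type B).1 (type B).2)

/-- The underlying atom. -/
def base : SubstAtom G → Atom type
  | gen B f => .gen B (f ∘ (rep B).inp) (f ∘ (rep B).out)
  | arrow x y => .arrow x y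

/-- The result of the substitution. -/
def atoms : SubstAtom G → Multiset (Atom typeH)
  | gen B f => (rep B).atoms.map (Atom.map f f)
  | arrow x y => {.arrow x y}

/-- The bound variables of the substituted molecule. -/
def bound : SubstAtom G → Multiset ℕ
  | gen B f => (rep B).bound.map f
  | arrow _ _ => 0

/-- Apply `g` to the upper indices and `h` to the lower indices. -/
def map (g h : ℕ → ℕ) : SubstAtom G → SubstAtom G
  -- One naming function serves upper and lower occurrences alike. Outputs occur only below and take
  -- `h`; inputs occur only above and take `g`; for bound variables the choice of `g` is harmless
  -- once `g` and `h` agree on their names.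
  | gen B f => gen B fun v => if ∃ k, (rep B).out k = v then h (f v) else g (f v)
  | arrow x y => arrow (g x) (h y)

theorem bind_ins (t : SubstAtom G) :
    (t.atoms rep).bind Atom.ins = (t.base rep).ins + t.bound rep := by
  cases t with
  | gen B f =>
    rw [atoms, OrderedMolecule.bind_ins_map, OrderedMolecule.bind_ins_eq]
    simp [base, bound, Atom.ins, Function.comp_def]
  | arrow x y => simp [atoms, base, bound, Atom.ins]

theorem bind_outs (t : SubstAtom G) :
    (t.atoms rep).bind Atom.outs = (t.base rep).outs + t.bound rep := by
  cases t with
  | gen B f =>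
    rw [atoms, OrderedMolecule.bind_outs_map, OrderedMolecule.bind_outs_eq]
    simp [base, bound, Atom.outs, Function.comp_def]
  | arrow x y => simp [atoms, base, bound, Atom.outs]

theorem not_exists_out_eq_inp {p q : ℕ} (M : OrderedMolecule type p q) (i : Fin p) : ¬ ∃ k, M.out k = M.inp i :=
  fun h => (M.inp_mem i).2 ((M.mem_range_out _).1 h).1

theorem base_map (g h : ℕ → ℕ) (t : SubstAtom G) :
    (t.map rep g h).base rep = (t.base rep).map g h := by
  cases t with
  | gen B f =>
    simp only [map, base, Atom.map, Atom.gen.injEq, heq_eq_eq, true_and]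
    constructor <;> funext k
    · simp only [Function.comp_apply, if_neg (not_exists_out_eq_inp (rep B) k)]
    · simp
  | arrow x y => rfl

/-- A bound variable occurs both above and below, so acting by `g` above and by `h` below amounts to
a new naming as soon as the two agree there. -/
theorem atoms_map (g h : ℕ → ℕ) (t : SubstAtom G) (ht : ∀ b ∈ t.bound rep, g b = h b) :
    (t.map rep g h).atoms rep = (t.atoms rep).map (Atom.map g h) := by
  cases t with
  | gen B f =>
    rw [map, atoms, atoms, Multiset.map_atoms_map]
    refine Multiset.map_atoms_congr _ (fun v hv => if_neg ?_) fun v hv => ?_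
    · rintro ⟨k, rfl⟩
      exact ((rep B).out_mem k).2 hv
    · split_ifs with hk
      · rfl
      · refine ht _ (Multiset.mem_map_of_mem _ (OrderedMolecule.mem_bound.2 ⟨?_, hv⟩))
        by_contra hv'
        exact hk (((rep B).mem_range_out v).2 ⟨hv, hv'⟩)
  | arrow x y => simp [map, atoms, Atom.map]

/-- The pairs of names that two substitutions for the same generator give to the bound variables. -/
def boundPairs : SubstAtom G → SubstAtom G → Multiset (ℕ × ℕ)
  | gen B f, gen _ f' => (rep B).bound.map fun b => (f b, f' b)
  | _, _ => 0

theorem boundPairs_fst {s t : SubstAtom G} (h : s.base rep = t.base rep) :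
    (boundPairs rep s t).map Prod.fst = s.bound rep := by
  cases s <;> cases t <;> simp_all [boundPairs, base, bound]

theorem boundPairs_snd {s t : SubstAtom G} (h : s.base rep = t.base rep) :
    (boundPairs rep s t).map Prod.snd = t.bound rep := by
  cases s <;> cases t
  · obtain ⟨rfl, -⟩ := Atom.gen.inj h
    simp [boundPairs, bound]
  all_goals simp_all [boundPairs, base, bound]

/-- Equal underlying atoms force the two namings to agree on the free variables of `rep B`. They can
differ only on its bound variables, and there `σ` translates one into the other. -/
theorem atoms_eq_map {s t : SubstAtom G} (h : s.base rep = t.base rep) (σ : ℕ → ℕ)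
    (hi : ∀ v ∈ (s.base rep).ins, σ v = v) (ho : ∀ v ∈ (s.base rep).outs, σ v = v)
    (hb : ∀ p ∈ boundPairs rep s t, σ p.1 = p.2) :
    t.atoms rep = (s.atoms rep).map (Atom.map σ σ) := by
  cases s with
  | gen B f =>
    cases t with
    | gen B' f' =>
      obtain ⟨rfl, h1, h2⟩ := Atom.gen.inj h
      rw [heq_eq_eq] at h1 h2
      have key : ∀ v, v ∈ (rep B).bound → f' v = σ (f v) := fun v hv =>
        (hb _ (Multiset.mem_map_of_mem _ hv)).symm
      rw [atoms, atoms, Multiset.map_atoms_map]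
      refine Multiset.map_atoms_congr _ (fun v hv => ?_) fun v hv => ?_
      · rw [OrderedMolecule.bind_ins_eq, Multiset.mem_add] at hv
        rcases hv with hv | hv
        · obtain ⟨k, -, rfl⟩ := Multiset.mem_map.1 hv
          exact (congrFun h1 k).symm.trans
            (hi _ (by simp [base, Atom.ins])).symm
        · exact key v hv
      · rw [OrderedMolecule.bind_outs_eq, Multiset.mem_add] at hv
        rcases hv with hv | hv
        · obtain ⟨k, -, rfl⟩ := Multiset.mem_map.1 hv
          exact (congrFun h2 k).symm.trans
            (ho _ (by simp [base, Atom.outs])).symm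
        · exact key v hv
    | arrow x y => simp [base] at h
  | arrow x y =>
    cases t with
    | gen B' f' => simp [base] at h
    | arrow x' y' =>
      obtain ⟨rfl, rfl⟩ := Atom.arrow.inj h
      simp [atoms, Atom.map, hi x (by simp [base, Atom.ins]), ho y (by simp [base, Atom.outs])]

/-- The atom prescribes the names of the free variables of `rep B`; a bound variable `v` is named `n
+ v`, so that a large `n` keeps it away from names already in use. -/
theorem exists_base_eq (a : Atom type) (n : ℕ) : ∃ t : SubstAtom G, t.base rep = a ∧
    (t.bound rep).Nodup ∧ ∀ b ∈ t.bound rep, n ≤ b := by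
  classical
  cases a with
  | gen B x y =>
    let f : ℕ → ℕ := fun v => if h : ∃ k, (rep B).inp k = v then x h.choose else
      if h : ∃ k, (rep B).out k = v then y h.choose else n + v
    have hf : ∀ v ∈ (rep B).bound, f v = n + v := fun v hv => by
      rw [OrderedMolecule.mem_bound] at hv
      have h1 := (rep B).mem_range_inp v
      have h2 := (rep B).mem_range_out v
      simp only [f]
      rw [dif_neg (by tauto), dif_neg (by tauto)]
    refine ⟨.gen B f, ?_, ?_, ?_⟩
    · simp only [base, Atom.gen.injEq, heq_eq_eq, true_and]
      constructor <;> funext k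
      · have h : ∃ k', (rep B).inp k' = (rep B).inp k := ⟨k, rfl⟩
        simp only [f, Function.comp_apply]
        rw [dif_pos h, (rep B).inp_injective h.choose_spec]
      · have h : ∃ k', (rep B).out k' = (rep B).out k := ⟨k, rfl⟩
        have h' : ¬ ∃ k', (rep B).inp k' = (rep B).out k := fun h =>
          ((rep B).out_mem k).2 (((rep B).mem_range_inp _).1 h).1
        simp only [f, Function.comp_apply]
        rw [dif_neg h', dif_pos h, (rep B).out_injective h.choose_spec]
    · refine Multiset.Nodup.map_on (fun a ha b hb e => ?_) (rep B).nodup_bound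
      rw [hf a ha, hf b hb] at e
      omega
    · intro b hb
      obtain ⟨v, hv, rfl⟩ := Multiset.mem_map.1 hb
      rw [hf v hv]
      omega
  | arrow x y => exact ⟨.arrow x y, rfl, by simp [bound], by simp [bound]⟩

end SubstAtom

/-! ### Substitution in a product of atoms -/

section Subst

variable {G : Type v} {type : G → ℕ × ℕ} {H : Type w} {typeH : H → ℕ × ℕ}
  (rep : ∀ B : G, OrderedMolecule typeH (type B).1 (type B).2)

/-- `L'` is obtained from `L` by substituting the molecules `rep B` for the generators `B`. -/
def IsSubst (L : Multiset (Atom type)) (L' : Multiset (Atom typeH)) : Prop :=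
  ∃ T : Multiset (SubstAtom G), T.map (SubstAtom.base rep) = L ∧ T.bind (SubstAtom.atoms rep) = L'

theorem SubstAtom.bind_bind_ins (T : Multiset (SubstAtom G)) :
    (T.bind (SubstAtom.atoms rep)).bind Atom.ins =
      (T.map (SubstAtom.base rep)).bind Atom.ins + T.bind (SubstAtom.bound rep) := by
  simp only [Multiset.bind_assoc, SubstAtom.bind_ins, Multiset.bind_add, Multiset.bind_map]

theorem SubstAtom.bind_bind_outs (T : Multiset (SubstAtom G)) :
    (T.bind (SubstAtom.atoms rep)).bind Atom.outs =
      (T.map (SubstAtom.base rep)).bind Atom.outs + T.bind (SubstAtom.bound rep) := by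
  simp only [Multiset.bind_assoc, SubstAtom.bind_outs, Multiset.bind_add, Multiset.bind_map]

variable {rep}

theorem IsSubst.zero : IsSubst rep 0 0 := ⟨0, by simp, by simp⟩

theorem IsSubst.singleton_arrow (x y : ℕ) : IsSubst rep {.arrow x y} {.arrow x y} :=
  ⟨{.arrow x y}, by simp [SubstAtom.base], by simp [SubstAtom.atoms]⟩

theorem IsSubst.singleton_gen (B : G) (f : ℕ → ℕ) :
    IsSubst rep {.gen B (f ∘ (rep B).inp) (f ∘ (rep B).out)}
      ((rep B).atoms.map (Atom.map f f)) :=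
  ⟨{.gen B f}, by simp [SubstAtom.base], by simp [SubstAtom.atoms]⟩

theorem IsSubst.add {L₁ L₂ : Multiset (Atom type)} {N₁ N₂ : Multiset (Atom typeH)}
    (h₁ : IsSubst rep L₁ N₁) (h₂ : IsSubst rep L₂ N₂) : IsSubst rep (L₁ + L₂) (N₁ + N₂) := by
  obtain ⟨T₁, rfl, rfl⟩ := h₁
  obtain ⟨T₂, rfl, rfl⟩ := h₂
  exact ⟨T₁ + T₂, by simp, by simp⟩

/-- Variables bound inside a substituted molecule occur above and below in `N`, where `f` and `g`
agree. This covers renamings (`f = g`) as well as absorptions and contractions, where one of the two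
maps is the identity. -/
theorem IsSubst.map {L : Multiset (Atom type)} {N : Multiset (Atom typeH)}
    (h : IsSubst rep L N) (f g : ℕ → ℕ)
    (hN : ∀ b ∈ N.bind Atom.ins, b ∈ N.bind Atom.outs → f b = g b) :
    IsSubst rep (L.map (Atom.map f g)) (N.map (Atom.map f g)) := by
  obtain ⟨T, rfl, rfl⟩ := h
  rw [SubstAtom.bind_bind_ins, SubstAtom.bind_bind_outs] at hN
  refine ⟨T.map (SubstAtom.map rep f g), ?_, ?_⟩
  · simp [SubstAtom.base_map]
  · rw [Multiset.bind_map, Multiset.map_bind]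
    refine Multiset.bind_congr fun t ht => SubstAtom.atoms_map rep f g t fun b hb => ?_
    have hb' : b ∈ T.bind (SubstAtom.bound rep) := Multiset.mem_bind.2 ⟨t, ht, hb⟩
    exact hN b (Multiset.mem_add.2 (.inr hb')) (Multiset.mem_add.2 (.inr hb'))

theorem IsSubst.of_cons_arrow {L : Multiset (Atom type)} {N : Multiset (Atom typeH)} {x y : ℕ}
    (h : IsSubst rep (.arrow x y ::ₘ L) N) : ∃ N', N = .arrow x y ::ₘ N' ∧ IsSubst rep L N' := by
  obtain ⟨T, hT, rfl⟩ := h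
  obtain ⟨t, ht, e⟩ := Multiset.mem_map.1 (hT.symm ▸ Multiset.mem_cons_self (Atom.arrow x y) L)
  obtain ⟨T, rfl⟩ := Multiset.exists_cons_of_mem ht
  rw [Multiset.map_cons, e, Multiset.cons_inj_right] at hT
  refine ⟨T.bind (SubstAtom.atoms rep), ?_, T, hT, rfl⟩
  cases t with
  | gen B f => simp [SubstAtom.base] at e
  | arrow x' y' =>
    obtain ⟨rfl, rfl⟩ := Atom.arrow.inj e
    simp [SubstAtom.atoms]

theorem IsSubst.mem_ins {L : Multiset (Atom type)} {N : Multiset (Atom typeH)}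
    (h : IsSubst rep L N) {v : ℕ} (hv : v ∈ L.bind Atom.ins) : v ∈ N.bind Atom.ins := by
  obtain ⟨T, rfl, rfl⟩ := h
  rw [SubstAtom.bind_bind_ins]
  exact Multiset.mem_add.2 (.inl hv)

theorem IsSubst.mem_outs {L : Multiset (Atom type)} {N : Multiset (Atom typeH)}
    (h : IsSubst rep L N) {v : ℕ} (hv : v ∈ L.bind Atom.outs) : v ∈ N.bind Atom.outs := by
  obtain ⟨T, rfl, rfl⟩ := h
  rw [SubstAtom.bind_bind_outs]
  exact Multiset.mem_add.2 (.inl hv)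

/-- The result of a substitution is unique up to renaming the bound variables. -/
theorem IsSubst.mk_eq {p q : ℕ} {L : Multiset (Atom type)} {N N' : OrderedMolecule typeH p q}
    (h : IsSubst rep L N.atoms) (h' : IsSubst rep L N'.atoms) (hi : N'.inp = N.inp)
    (ho : N'.out = N.out) : Monomial.mk N = Monomial.mk N' := by
  obtain ⟨T, rfl, hN⟩ := h
  obtain ⟨T', e, hN'⟩ := h'
  obtain ⟨P, rfl, rfl, hP⟩ := Multiset.exists_pairing e.symm
  -- Since no index repeats in `N`, the internal bound variables are distinct from one another and
  -- from all variables of the underlying product.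
  have key : ∀ {N : OrderedMolecule typeH p q} {T : Multiset (SubstAtom G)},
      T.bind (SubstAtom.atoms rep) = N.atoms → (T.bind (SubstAtom.bound rep)).Nodup ∧
        ∀ v ∈ T.bind (SubstAtom.bound rep), v ∉ (T.map (SubstAtom.base rep)).bind Atom.ins ∧
          v ∉ (T.map (SubstAtom.base rep)).bind Atom.outs := by
    intro N T hN
    have ni := N.nodup_ins
    have no := N.nodup_outs
    rw [← hN, SubstAtom.bind_bind_ins, Multiset.nodup_add] at ni
    rw [← hN, SubstAtom.bind_bind_outs, Multiset.nodup_add] at no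
    exact ⟨ni.2.1, fun v hv => ⟨Multiset.disjoint_right.1 ni.2.2 hv,
      Multiset.disjoint_right.1 no.2.2 hv⟩⟩
  let L := (P.map Prod.fst).map (SubstAtom.base rep)
  let W := P.bind fun p => SubstAtom.boundPairs rep p.1 p.2
  have w1 : W.map Prod.fst = (P.map Prod.fst).bind (SubstAtom.bound rep) := by
    rw [Multiset.map_bind, Multiset.bind_map]
    exact Multiset.bind_congr fun p hp => SubstAtom.boundPairs_fst rep (hP p hp)
  have w2 : W.map Prod.snd = (P.map Prod.snd).bind (SubstAtom.bound rep) := by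
    rw [Multiset.map_bind, Multiset.bind_map]
    exact Multiset.bind_congr fun p hp => SubstAtom.boundPairs_snd rep (hP p hp)
  obtain ⟨n1, d1⟩ := key hN
  obtain ⟨n2, d2⟩ := key hN'
  rw [← w1] at n1 d1
  rw [← w2, e] at d2
  rw [← w2] at n2
  -- This permutation translates the internal names of the first substitution into those of the
  -- second and fixes every variable of `L`.
  obtain ⟨σ, hS, hW⟩ := Finset.exists_perm_of_pairs
    ((L.bind Atom.ins).toFinset ∪ (L.bind Atom.outs).toFinset) W n1 n2
    (fun p hp => by
      have := d1 _ (Multiset.mem_map_of_mem _ hp)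
      simpa only [Finset.mem_union, Multiset.mem_toFinset, not_or] using this)
    (fun p hp => by
      have := d2 _ (Multiset.mem_map_of_mem _ hp)
      simpa only [Finset.mem_union, Multiset.mem_toFinset, not_or] using this)
  simp only [Finset.mem_union, Multiset.mem_toFinset] at hS
  refine Quot.sound (.rename N N' σ ?_ ?_ ?_)
  · rw [← hN, ← hN', Multiset.bind_map, Multiset.bind_map, Multiset.map_bind]
    refine Multiset.bind_congr fun p hp => SubstAtom.atoms_eq_map rep (hP p hp) σ ?_ ?_ ?_
    · exact fun v hv => hS v (.inl (Multiset.mem_bind.2 ⟨_, Multiset.mem_map_of_mem _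
        (Multiset.mem_map_of_mem _ hp), hv⟩))
    · exact fun v hv => hS v (.inr (Multiset.mem_bind.2 ⟨_, Multiset.mem_map_of_mem _
        (Multiset.mem_map_of_mem _ hp), hv⟩))
    · exact fun x hx => hW x (Multiset.mem_bind.2 ⟨p, hp, hx⟩)
  · rw [hi]
    funext k
    have h := N.inp_mem k
    rw [← hN, SubstAtom.bind_bind_ins, SubstAtom.bind_bind_outs, Multiset.mem_add,
      Multiset.mem_add] at h
    -- A free variable of `N` cannot be internal, because internal variables occur on both sides; so
    -- it occurs in `L` and is fixed.
    exact (hS _ (.inl (by tauto))).symm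
  · rw [ho]
    funext k
    have h := N.out_mem k
    rw [← hN, SubstAtom.bind_bind_ins, SubstAtom.bind_bind_outs, Multiset.mem_add,
      Multiset.mem_add] at h
    exact (hS _ (.inr (by tauto))).symm

variable (rep) in
-- The bound variables of each further atom are named beyond the largest name used for the previous
-- ones.
theorem SubstAtom.exists_multiset (L : Multiset (Atom type)) (n : ℕ) :
    ∃ T : Multiset (SubstAtom G), T.map (SubstAtom.base rep) = L ∧
      (T.bind (SubstAtom.bound rep)).Nodup ∧ ∀ b ∈ T.bind (SubstAtom.bound rep), n ≤ b := by
  induction L using Multiset.induction_on with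
  | empty => exact ⟨0, by simp⟩
  | cons a L ih =>
    obtain ⟨T, rfl, hT, hn⟩ := ih
    obtain ⟨t, rfl, ht, htn⟩ := SubstAtom.exists_base_eq rep a
      (n + (T.bind (SubstAtom.bound rep)).toFinset.sup id + 1)
    refine ⟨t ::ₘ T, by simp, ?_, ?_⟩
    · rw [Multiset.cons_bind, Multiset.nodup_add]
      refine ⟨ht, hT, Multiset.disjoint_left.2 fun {b} hb hb' => ?_⟩
      have h1 := htn b hb
      have h2 := Finset.le_sup (f := id) (Multiset.mem_toFinset.2 hb')
      simp only [id] at h2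
      omega
    · intro b hb
      rw [Multiset.cons_bind, Multiset.mem_add] at hb
      rcases hb with hb | hb
      · have := htn b hb
        omega
      · exact hn b hb

variable (rep) in
/-- Substitution into a molecule is possible. -/
theorem OrderedMolecule.exists_isSubst {G₀ : Type*} {type₀ : G₀ → ℕ × ℕ} {p q : ℕ}
    (M : OrderedMolecule type₀ p q) (L : Multiset (Atom type))
    (hi : L.bind Atom.ins = M.atoms.bind Atom.ins)
    (ho : L.bind Atom.outs = M.atoms.bind Atom.outs) :
    ∃ N : OrderedMolecule typeH p q, N.inp = M.inp ∧ N.out = M.out ∧ IsSubst rep L N.atoms := by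
  -- Internal names start beyond every variable of `M`, which also are the variables of `L`; no
  -- index is then repeated.
  obtain ⟨T, rfl, hT, hn⟩ := SubstAtom.exists_multiset rep L
    ((M.atoms.bind Atom.ins).toFinset.sup id + (M.atoms.bind Atom.outs).toFinset.sup id + 1)
  have hB : ∀ {s : Multiset ℕ}, (s = M.atoms.bind Atom.ins ∨ s = M.atoms.bind Atom.outs) →
      Disjoint s (T.bind (SubstAtom.bound rep)) := by
    intro s hs
    refine Multiset.disjoint_left.2 fun {b} hb hb' => ?_
    have h1 := hn b hb'
    have h2 := Finset.le_sup (f := id) (Multiset.mem_toFinset.2 hb)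
    simp only [id] at h2
    rcases hs with rfl | rfl <;> omega
  obtain ⟨N, hN, hNi, hNo⟩ := M.exists_of_add_bound (T.bind (SubstAtom.atoms rep))
    (T.bind (SubstAtom.bound rep)) (by rw [SubstAtom.bind_bind_ins, hi])
    (by rw [SubstAtom.bind_bind_outs, ho])
    (by
      rw [SubstAtom.bind_bind_ins, hi, Multiset.nodup_add]
      exact ⟨M.nodup_ins, hT, hB (.inl rfl)⟩)
    (by
      rw [SubstAtom.bind_bind_outs, ho, Multiset.nodup_add]
      exact ⟨M.nodup_outs, hT, hB (.inr rfl)⟩)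
  exact ⟨N, hNi, hNo, T, rfl, hN.symm⟩

end Subst

theorem OrderedMolecule.nodup_free {G : Type*} {type : G → ℕ × ℕ} {p q : ℕ}
    (M : OrderedMolecule type p q) :
    (Finset.univ.val.map M.inp + Finset.univ.val.map M.out).Nodup := by
  rw [Multiset.nodup_add]
  refine ⟨Finset.univ.nodup.map M.inp_injective, Finset.univ.nodup.map M.out_injective,
    Multiset.disjoint_left.2 fun {b} hb hb' => ?_⟩
  obtain ⟨k, -, rfl⟩ := Multiset.mem_map.1 hb
  obtain ⟨l, -, h⟩ := Multiset.mem_map.1 hb'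
  exact (M.inp_mem k).2 (h ▸ (M.out_mem l).1)

/-- Inputs and outputs together are pairwise distinct variables in each molecule, so matching them
by position is a finite partial injection. -/
theorem OrderedMolecule.exists_perm_free {G H : Type*} {type : G → ℕ × ℕ} {typeH : H → ℕ × ℕ}
    {p q : ℕ} (M : OrderedMolecule type p q) (N : OrderedMolecule typeH p q) :
    ∃ σ : Equiv.Perm ℕ, σ ∘ M.inp = N.inp ∧ σ ∘ M.out = N.out := by
  obtain ⟨σ, -, hσ⟩ := Finset.exists_perm_of_pairs ∅
    (Finset.univ.val.map (fun k => (M.inp k, N.inp k)) +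
      Finset.univ.val.map (fun k => (M.out k, N.out k)))
    (by simpa [Function.comp_def] using M.nodup_free)
    (by simpa [Function.comp_def] using N.nodup_free) (by simp) (by simp)
  refine ⟨σ, funext fun k => ?_, funext fun k => ?_⟩
  · exact hσ (M.inp k, N.inp k)
      (Multiset.mem_add.2 (.inl (Multiset.mem_map_of_mem _ (Finset.mem_univ k))))
  · exact hσ (M.out k, N.out k)
      (Multiset.mem_add.2 (.inr (Multiset.mem_map_of_mem _ (Finset.mem_univ k))))

/-! ### Multilinear expansion and the substitution map on molecules -/

section Expand

variable {K : Type u} [Field K] {G : Type v} (type : G → ℕ × ℕ) {H : Type w} (typeH : H → ℕ × ℕ)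
  {p q p₁ q₁ p₂ q₂ : ℕ}

/-- Generators decorated with a monomial to be substituted for them. -/
abbrev DecoratedGen : Type (max v w) := Σ A : G, Monomial typeH (type A).1 (type A).2

/-- The type of a decorated generator. -/
abbrev decoratedType (B : DecoratedGen type typeH) : ℕ × ℕ := type B.1

/-- A molecule representing the decoration of a decorated generator. -/
noncomputable def decoration (B : DecoratedGen type typeH) :
    OrderedMolecule typeH (decoratedType type typeH B).1 (decoratedType type typeH B).2 :=
  Quot.out B.2

/-- Formal linear combinations of products of decorated atoms. -/
abbrev DecoratedAlgebra (K : Type u) [Field K] {G : Type v} (type : G → ℕ × ℕ) {H : Type w}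
    (typeH : H → ℕ × ℕ) : Type (max u v w) :=
  -- Multiplication is union of multisets, so the algebra is commutative and multilinear expansion
  -- is a product over the atoms. The multisets need not satisfy the conditions on a molecule.
  AddMonoidAlgebra K (Multiset (Atom (decoratedType type typeH)))

variable {type typeH}

/-- Apply `f` to the upper indices and `g` to the lower indices. -/
noncomputable def DecoratedAlgebra.map (f g : ℕ → ℕ) :
    DecoratedAlgebra K type typeH →ₐ[K] DecoratedAlgebra K type typeH :=
  AddMonoidAlgebra.mapDomainAlgHom K K (Multiset.mapAddMonoidHom (Atom.map f g))

theorem DecoratedAlgebra.map_single (f g : ℕ → ℕ)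
    (L : Multiset (Atom (decoratedType type typeH))) (c : K) :
    DecoratedAlgebra.map f g (.single L c : DecoratedAlgebra K type typeH) =
      .single (L.map (Atom.map f g)) c := by
  simp [DecoratedAlgebra.map]

variable (ψ : ∀ A : G, Monomial typeH (type A).1 (type A).2 →₀ K)

/-- Replace a generator by a linear combination of decorated generators. -/
noncomputable def expandAtom : Atom type → DecoratedAlgebra K type typeH
  | .gen A x y => (ψ A).sum fun m c => .single {.gen ⟨A, m⟩ x y} c
  | .arrow x y => .single {.arrow x y} 1

/-- Multilinear expansion of a product of atoms. -/
noncomputable def expand (L : Multiset (Atom type)) : DecoratedAlgebra K type typeH :=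
  (L.map (expandAtom ψ)).prod

theorem expandAtom_map (f g : ℕ → ℕ) (a : Atom type) :
    expandAtom ψ (a.map f g) = DecoratedAlgebra.map f g (expandAtom ψ a) := by
  cases a with
  | gen A x y =>
    simp only [Atom.map, expandAtom, Finsupp.sum, map_sum, DecoratedAlgebra.map_single,
      Multiset.map_singleton]
  | arrow x y => simp only [Atom.map, expandAtom, DecoratedAlgebra.map_single,
      Multiset.map_singleton]

theorem expand_map (f g : ℕ → ℕ) (L : Multiset (Atom type)) :
    expand ψ (L.map (Atom.map f g)) = DecoratedAlgebra.map f g (expand ψ L) := by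
  simp only [expand, Multiset.map_map, map_multiset_prod, Function.comp_apply,
    expandAtom_map]

theorem expand_add (L L' : Multiset (Atom type)) :
    expand ψ (L + L') = expand ψ L * expand ψ L' := by
  simp [expand]

theorem expand_cons_arrow (x y : ℕ) (L : Multiset (Atom type)) :
    expand ψ (.arrow x y ::ₘ L) = .single {.arrow x y} 1 * expand ψ L := by
  simp [expand, expandAtom]

/-- Decorating a generator leaves its indices unchanged. Linear identities on expansions may
therefore be checked on single decorated products with the same indices as `L`. -/
theorem expand_mem_span (L : Multiset (Atom type)) :
    expand ψ L ∈ Submodule.span K {x | ∃ L' : Multiset (Atom (decoratedType type typeH)),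
      L'.bind Atom.ins = L.bind Atom.ins ∧ L'.bind Atom.outs = L.bind Atom.outs ∧
      x = AddMonoidAlgebra.single L' 1} := by
  induction L using Multiset.induction_on with
  | empty => exact Submodule.subset_span ⟨0, by simp, by simp, rfl⟩
  | cons a L ih =>
    have ha : expandAtom ψ a ∈ Submodule.span K
        {x | ∃ a' : Atom (decoratedType type typeH), a'.ins = a.ins ∧ a'.outs = a.outs ∧
          x = AddMonoidAlgebra.single {a'} 1} := by
      cases a with
      | gen A x y =>
        refine Submodule.sum_mem _ fun m _ => ?_
        dsimp only
        rw [← mul_one (ψ A m), ← smul_eq_mul, ← AddMonoidAlgebra.smul_single]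
        exact Submodule.smul_mem _ _ (Submodule.subset_span ⟨_, rfl, rfl, rfl⟩)
      | arrow x y => exact Submodule.subset_span ⟨_, rfl, rfl, rfl⟩
    have := Submodule.mul_mem_mul ha ih
    rw [Submodule.span_mul_span] at this
    rw [expand, Multiset.map_cons, Multiset.prod_cons]
    refine Submodule.span_mono ?_ this
    rintro _ ⟨_, ⟨a', h1, h2, rfl⟩, _, ⟨L', h3, h4, rfl⟩, rfl⟩
    exact ⟨a' ::ₘ L', by simp [h1, h3], by simp [h2, h4], by
      simp [AddMonoidAlgebra.single_mul_single]⟩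

variable {ψ} in
/-- Linear maps that agree on products of decorated atoms agree on expansions. -/
theorem expand_hom_ext {V : Type*} [AddCommMonoid V] [Module K V]
    {F F' : DecoratedAlgebra K type typeH → V} (hF : IsLinearMap K F) (hF' : IsLinearMap K F')
    (L : Multiset (Atom type))
    (h : ∀ L' : Multiset (Atom (decoratedType type typeH)),
      L'.bind Atom.ins = L.bind Atom.ins → L'.bind Atom.outs = L.bind Atom.outs →
      F (.single L' 1) = F' (.single L' 1)) : F (expand ψ L) = F' (expand ψ L) := by
  have hL := expand_mem_span ψ L
  generalize expand ψ L = t at hL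
  induction hL using Submodule.span_induction with
  | mem x hx =>
    obtain ⟨L', h1, h2, rfl⟩ := hx
    exact h L' h1 h2
  | zero => rw [hF.map_zero, hF'.map_zero]
  | add x y _ _ hx hy => rw [hF.map_add, hF'.map_add, hx, hy]
  | smul c x _ hx => rw [hF.map_smul, hF'.map_smul, hx]

open Classical in
variable (K) in
/-- The monomial obtained by substituting decorations, with given free variables. -/
noncomputable def substMonomial (inp : Fin p → ℕ) (out : Fin q → ℕ)
    (L : Multiset (Atom (decoratedType type typeH))) : Monomial typeH p q →₀ K :=
  if h : ∃ N : OrderedMolecule typeH p q, N.inp = inp ∧ N.out = out ∧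
    IsSubst (decoration type typeH) L N.atoms then .single (Monomial.mk h.choose) 1 else 0

/-- The chosen molecule may be replaced by any other result of the substitution, by `IsSubst.mk_eq`.
-/
theorem substMonomial_eq {L : Multiset (Atom (decoratedType type typeH))}
    (N : OrderedMolecule typeH p q) {inp : Fin p → ℕ} {out : Fin q → ℕ}
    (hN : IsSubst (decoration type typeH) L N.atoms) (hi : N.inp = inp) (ho : N.out = out) :
    substMonomial K inp out L = .single (Monomial.mk N) 1 := by
  have h : ∃ N : OrderedMolecule typeH p q, N.inp = inp ∧ N.out = out ∧
    IsSubst (decoration type typeH) L N.atoms := ⟨N, hi, ho, hN⟩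
  rw [substMonomial, dif_pos h]
  obtain ⟨h1, h2, h3⟩ := h.choose_spec
  rw [IsSubst.mk_eq h3 hN (hi.trans h1.symm) (ho.trans h2.symm)]

/-- The linear extension of `substMonomial`. -/
noncomputable def substLinear (inp : Fin p → ℕ) (out : Fin q → ℕ) :
    DecoratedAlgebra K type typeH →ₗ[K] (Monomial typeH p q →₀ K) :=
  Finsupp.linearCombination K (substMonomial K inp out) ∘ₗ
    (AddMonoidAlgebra.coeffLinearEquiv K).toLinearMap

theorem substLinear_single (inp : Fin p → ℕ) (out : Fin q → ℕ)
    (L : Multiset (Atom (decoratedType type typeH))) (c : K) :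
    substLinear inp out (.single L c : DecoratedAlgebra K type typeH) =
      c • substMonomial K inp out L := by
  simp [substLinear]

theorem substLinear_single_eq {L : Multiset (Atom (decoratedType type typeH))}
    (N : OrderedMolecule typeH p q) {inp : Fin p → ℕ} {out : Fin q → ℕ}
    (hN : IsSubst (decoration type typeH) L N.atoms) (hi : N.inp = inp) (ho : N.out = out) :
    substLinear inp out (.single L 1 : DecoratedAlgebra K type typeH) =
      .single (Monomial.mk N) 1 := by
  rw [substLinear_single, one_smul, substMonomial_eq N hN hi ho]

/-- Substitution of linear combinations of monomials for the generators in a molecule. -/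
noncomputable def substMolecule (M : OrderedMolecule type p q) : Monomial typeH p q →₀ K :=
  substLinear M.inp M.out (expand ψ M.atoms)

/-- On a decorated product the arrow survives substitution and still meets a lower index `x`.
Absorbing it after the substitution gives the same result as before. -/
theorem substMolecule_of_absorb_out {M N : OrderedMolecule type p q} {x z : ℕ}
    {L : Multiset (Atom type)} (hi : N.inp = M.inp) (ho : N.out = M.out)
    (hM : M.atoms = .arrow x z ::ₘ L) (hx : x ∈ L.bind Atom.outs)
    (hN : N.atoms = L.map (Atom.map id (OrderedMolecule.subst z x))) :
    substMolecule ψ M = substMolecule ψ N := by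
  rw [substMolecule, substMolecule, hi, ho, hM, hN, expand_map, expand_cons_arrow]
  refine expand_hom_ext (ψ := ψ)
    (F := fun t => substLinear M.inp M.out
      ((.single {.arrow x z} 1 : DecoratedAlgebra K type typeH) * t))
    (F' := fun t => substLinear M.inp M.out (DecoratedAlgebra.map id (OrderedMolecule.subst z x) t))
    ⟨fun _ _ => by simp only [mul_add, map_add],
      fun _ _ => by simp only [mul_smul_comm, map_smul]⟩
    ⟨fun _ _ => by simp only [map_add], fun _ _ => by simp only [map_smul]⟩ L fun L' h1 h2 => ?_
  simp only [DecoratedAlgebra.map_single, AddMonoidAlgebra.single_mul_single, mul_one,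
    Multiset.singleton_add]
  obtain ⟨N₁, h3, h4, h5⟩ := M.exists_isSubst (decoration type typeH) (.arrow x z ::ₘ L')
    (by rw [hM, Multiset.cons_bind, Multiset.cons_bind, h1]; rfl)
    (by rw [hM, Multiset.cons_bind, Multiset.cons_bind, h2]; rfl)
  obtain ⟨L₁, h6, h7⟩ := h5.of_cons_arrow
  obtain ⟨N₂, h8, h9, h10, h11⟩ := N₁.exists_absorb_out x z L₁ h6 (h7.mem_outs (h2 ▸ hx))
  rw [substLinear_single_eq N₁ h5 h3 h4, substLinear_single_eq N₂ ?_ (h9.trans h3) (h10.trans h4),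
    h11]
  rw [h8]
  have ni := N₁.nodup_ins
  rw [h6] at ni
  -- The arrow already uses `x` as an upper index, so `x` is not bound within the remaining atoms
  -- and may be replaced among the lower indices alone.
  have hx' := OrderedMolecule.cons_notMem ni (v := x) (by simp [Atom.ins])
  exact h7.map _ _ fun b hb _ => (OrderedMolecule.subst_of_ne z (ne_of_mem_of_not_mem hb hx')).symm

theorem substMolecule_of_absorb_in {M N : OrderedMolecule type p q} {x z : ℕ}
    {L : Multiset (Atom type)} (hi : N.inp = M.inp) (ho : N.out = M.out)
    (hM : M.atoms = .arrow z x ::ₘ L) (hx : x ∈ L.bind Atom.ins)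
    (hN : N.atoms = L.map (Atom.map (OrderedMolecule.subst z x) id)) :
    substMolecule ψ M = substMolecule ψ N := by
  rw [substMolecule, substMolecule, hi, ho, hM, hN, expand_map, expand_cons_arrow]
  refine expand_hom_ext (ψ := ψ)
    (F := fun t => substLinear M.inp M.out
      ((.single {.arrow z x} 1 : DecoratedAlgebra K type typeH) * t))
    (F' := fun t => substLinear M.inp M.out (DecoratedAlgebra.map (OrderedMolecule.subst z x) id t))
    ⟨fun _ _ => by simp only [mul_add, map_add],
      fun _ _ => by simp only [mul_smul_comm, map_smul]⟩
    ⟨fun _ _ => by simp only [map_add], fun _ _ => by simp only [map_smul]⟩ L fun L' h1 h2 => ?_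
  simp only [DecoratedAlgebra.map_single, AddMonoidAlgebra.single_mul_single, mul_one,
    Multiset.singleton_add]
  obtain ⟨N₁, h3, h4, h5⟩ := M.exists_isSubst (decoration type typeH) (.arrow z x ::ₘ L')
    (by rw [hM, Multiset.cons_bind, Multiset.cons_bind, h1]; rfl)
    (by rw [hM, Multiset.cons_bind, Multiset.cons_bind, h2]; rfl)
  obtain ⟨L₁, h6, h7⟩ := h5.of_cons_arrow
  obtain ⟨N₂, h8, h9, h10, h11⟩ := N₁.exists_absorb_in x z L₁ h6 (h7.mem_ins (h1 ▸ hx))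
  rw [substLinear_single_eq N₁ h5 h3 h4, substLinear_single_eq N₂ ?_ (h9.trans h3) (h10.trans h4),
    h11]
  rw [h8]
  have no := N₁.nodup_outs
  rw [h6] at no
  have hx' := OrderedMolecule.cons_notMem no (v := x) (by simp [Atom.outs])
  exact h7.map _ _ fun b _ hb => OrderedMolecule.subst_of_ne z (ne_of_mem_of_not_mem hb hx')

theorem substMolecule_of_rename {M N : OrderedMolecule type p q} (σ : Equiv.Perm ℕ)
    (hN : N.atoms = M.atoms.map (Atom.map σ σ)) (hi : N.inp = σ ∘ M.inp)
    (ho : N.out = σ ∘ M.out) : substMolecule ψ M = substMolecule ψ N := by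
  rw [substMolecule, substMolecule, hN, expand_map]
  refine expand_hom_ext (F := fun t => substLinear M.inp M.out t)
    (F' := fun t => substLinear N.inp N.out (DecoratedAlgebra.map _ _ t))
    ⟨fun _ _ => by simp only [map_add], fun _ _ => by simp only [map_smul]⟩
    ⟨fun _ _ => by simp only [map_add], fun _ _ => by simp only [map_smul]⟩ _ fun L' h1 h2 => ?_
  simp only [DecoratedAlgebra.map_single]
  obtain ⟨N₁, h3, h4, h5⟩ := M.exists_isSubst (decoration type typeH) L' h1 h2
  obtain ⟨N₂, h6, h7, h8⟩ := N₁.exists_rename σ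
  rw [substLinear_single_eq N₁ h5 h3 h4, substLinear_single_eq N₂ ?_ (by rw [h7, h3, hi])
    (by rw [h8, h4, ho]), show Monomial.mk N₁ = Monomial.mk N₂ from
      Quot.sound (.rename _ _ σ h6 h7 h8)]
  rw [h6]
  exact h5.map _ _ fun _ _ _ => rfl

theorem substMolecule_of_move {M N : OrderedMolecule type p q} (h : OrderedMolecule.Move M N) :
    substMolecule ψ M = substMolecule ψ N := by
  rcases h.absorb_or_rename with ⟨hi, ho, x, z, L, hM, hx, hN⟩ | ⟨hi, ho, x, z, L, hM, hx, hN⟩ |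
    ⟨σ, hN, hi, ho⟩
  · exact substMolecule_of_absorb_out ψ hi ho hM hx hN
  · exact substMolecule_of_absorb_in ψ hi ho hM hx hN
  · exact substMolecule_of_rename ψ σ hN hi ho

theorem substMolecule_empty :
    substMolecule ψ (OrderedMolecule.empty (type := type)) =
      .single (Monomial.mk OrderedMolecule.empty) 1 :=
  substLinear_single_eq OrderedMolecule.empty IsSubst.zero rfl rfl

theorem substMolecule_arrow :
    substMolecule ψ (OrderedMolecule.arrow (type := type)) =
      .single (Monomial.mk OrderedMolecule.arrow) 1 := by
  rw [substMolecule]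
  have : expand ψ (OrderedMolecule.arrow (type := type)).atoms = .single {.arrow 0 1} 1 := by
    simp [OrderedMolecule.arrow, expand, expandAtom]
  rw [this]
  exact substLinear_single_eq OrderedMolecule.arrow (IsSubst.singleton_arrow 0 1) rfl rfl

/-- The expansion is a sum of single atoms decorated by the monomials `m` of `ψ A`. Substitution
turns each into the chosen representative of `m` with renamed variables, whose class is `m`. -/
theorem substMolecule_gen (A : G) : substMolecule ψ (OrderedMolecule.gen A) = ψ A := by
  have key : ∀ m : Monomial typeH (type A).1 (type A).2,
      substMonomial K (OrderedMolecule.gen (type := type) A).inp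
        (OrderedMolecule.gen (type := type) A).out
        {.gen ⟨A, m⟩ (OrderedMolecule.gen (type := type) A).inp
          (OrderedMolecule.gen (type := type) A).out} = .single m 1 := by
    intro m
    obtain ⟨σ, h1, h2⟩ := (decoration type typeH ⟨A, m⟩).exists_perm_free
      (OrderedMolecule.gen (type := type) A)
    obtain ⟨N, h3, h4, h5⟩ := (decoration type typeH ⟨A, m⟩).exists_rename σ
    rw [substMonomial_eq N ?_ (h4.trans h1) (h5.trans h2)]
    · congr 1
      exact (Quot.sound (.rename _ _ σ h3 h4 h5) : Quot.mk _ _ = Monomial.mk N).symm.trans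
        (Quot.out_eq m)
    · rw [h3, ← h1, ← h2]
      exact IsSubst.singleton_gen (rep := decoration type typeH) ⟨A, m⟩ σ
  have : expand ψ (OrderedMolecule.gen (type := type) A).atoms =
      (ψ A).sum fun m c => .single {.gen ⟨A, m⟩ (OrderedMolecule.gen (type := type) A).inp
          (OrderedMolecule.gen (type := type) A).out} c := by
    simp [OrderedMolecule.gen, expand, expandAtom]
  rw [substMolecule, this, Finsupp.sum, map_sum]
  simp only [substLinear_single, key, Finsupp.smul_single, smul_eq_mul, mul_one]
  exact Finsupp.sum_single (ψ A)

variable (K typeH) in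
/-- The tensor product of the free wheeled PROP. -/
noncomputable abbrev freeTensor :
    (Monomial typeH p₁ q₁ →₀ K) →ₗ[K] (Monomial typeH p₂ q₂ →₀ K) →ₗ[K]
      (Monomial typeH (p₁ + p₂) (q₁ + q₂) →₀ K) :=
  Finsupp.lift _ K _ fun m => Finsupp.lmapDomain K K (Monomial.tensor m)

theorem freeTensor_single (m : Monomial typeH p₁ q₁) (n : Monomial typeH p₂ q₂) :
    freeTensor K typeH (.single m 1) (.single n 1) = .single (m.tensor n) 1 := by
  simp [freeTensor]

/-- Expansion turns juxtaposition into multiplication, so both sides are bilinear in the two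
expansions. On decorated products, substitution commutes with renaming apart and with union. -/
theorem substMolecule_tensor (M : OrderedMolecule type p₁ q₁) (N : OrderedMolecule type p₂ q₂) :
    substMolecule ψ (M.tensor N) =
      freeTensor K typeH (substMolecule ψ M) (substMolecule ψ N) := by
  rw [substMolecule]
  simp only [OrderedMolecule.tensor, OrderedMolecule.disjointUnion]
  rw [expand_add, expand_map, expand_map]
  -- Linearity in the first factor is used here with the second fixed to a decorated product;
  -- linearity in the second finishes the proof.
  have key : ∀ L₂ : Multiset (Atom (decoratedType type typeH)),
      L₂.bind Atom.ins = N.atoms.bind Atom.ins → L₂.bind Atom.outs = N.atoms.bind Atom.outs →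
      substLinear (M.tensor N).inp (M.tensor N).out
        (DecoratedAlgebra.map (fun n => 2 * n) (fun n => 2 * n) (expand ψ M.atoms) *
          DecoratedAlgebra.map (fun n => 2 * n + 1) (fun n => 2 * n + 1) (.single L₂ 1)) =
        freeTensor K typeH (substMolecule ψ M) (substLinear N.inp N.out (.single L₂ 1)) := by
    intro L₂ h1 h2
    refine expand_hom_ext
      (F := fun t => substLinear (M.tensor N).inp (M.tensor N).out
        (DecoratedAlgebra.map _ _ t * DecoratedAlgebra.map _ _ (.single L₂ 1)))
      (F' := fun t => freeTensor K typeH (substLinear M.inp M.out t)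
        (substLinear N.inp N.out (.single L₂ 1)))
      ⟨fun _ _ => by simp only [add_mul, map_add],
        fun _ _ => by simp only [smul_mul_assoc, map_smul]⟩
      ⟨fun _ _ => by simp only [map_add, LinearMap.add_apply],
        fun _ _ => by simp only [map_smul, LinearMap.smul_apply]⟩ _ fun L₁ h3 h4 => ?_
    obtain ⟨M', h5, h6, h7⟩ := M.exists_isSubst (decoration type typeH) L₁ h3 h4
    obtain ⟨N', h8, h9, h10⟩ := N.exists_isSubst (decoration type typeH) L₂ h1 h2
    simp only [DecoratedAlgebra.map_single, AddMonoidAlgebra.single_mul_single, mul_one]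
    rw [substLinear_single_eq M' h7 h5 h6, substLinear_single_eq N' h10 h8 h9,
      substLinear_single_eq (M'.tensor N') ?_ ?_ ?_, freeTensor_single]
    · rfl
    · exact (h7.map _ _ fun _ _ _ => rfl).add (h10.map _ _ fun _ _ _ => rfl)
    · simp only [OrderedMolecule.tensor, h5, h8]
    · simp only [OrderedMolecule.tensor, h6, h9]
  exact expand_hom_ext
    (F := fun t => substLinear (M.tensor N).inp (M.tensor N).out
      (DecoratedAlgebra.map _ _ (expand ψ M.atoms) * DecoratedAlgebra.map _ _ t))
    (F' := fun t => freeTensor K typeH (substMolecule ψ M) (substLinear N.inp N.out t))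
    ⟨fun _ _ => by simp only [mul_add, map_add],
      fun _ _ => by simp only [mul_smul_comm, map_smul]⟩
    ⟨fun _ _ => by simp only [map_add], fun _ _ => by simp only [map_smul]⟩ _ key

/-- An output variable remains an output after substitution. It is never an upper index, so
replacing it among the lower indices touches no bound variable and commutes with substitution. -/
theorem substMolecule_contr (i : Fin (p + 1)) (j : Fin (q + 1))
    (M : OrderedMolecule type (p + 1) (q + 1)) :
    substMolecule ψ (M.contr i j) =
      Finsupp.lmapDomain K K (Monomial.contr i j) (substMolecule ψ M) := by
  rw [substMolecule]
  simp only [OrderedMolecule.contr]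
  rw [expand_map]
  refine expand_hom_ext
    (F := fun t => substLinear (M.contr i j).inp (M.contr i j).out (DecoratedAlgebra.map _ _ t))
    (F' := fun t => Finsupp.lmapDomain K K (Monomial.contr i j) (substLinear M.inp M.out t))
    ⟨fun _ _ => by simp only [map_add], fun _ _ => by simp only [map_smul]⟩
    ⟨fun _ _ => by simp only [map_add], fun _ _ => by simp only [map_smul]⟩ _ fun L h1 h2 => ?_
  obtain ⟨N, h3, h4, h5⟩ := M.exists_isSubst (decoration type typeH) L h1 h2
  simp only [DecoratedAlgebra.map_single]
  rw [substLinear_single_eq N h5 h3 h4, substLinear_single_eq (N.contr i j) ?_ ?_ ?_,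
    Finsupp.lmapDomain_apply, Finsupp.mapDomain_single]
  · rfl
  · rw [← h3, ← h4]
    refine h5.map _ _ fun b hb _ => (OrderedMolecule.subst_of_ne _ ?_).symm
    exact ne_of_mem_of_not_mem hb (N.out_mem j).2
  · simp only [OrderedMolecule.contr, h3]
  · simp only [OrderedMolecule.contr, h4]

end Expand

/-! ### Reordering a list by moves to the end -/

/-- Two enumerations of the same set differ by moves of one entry to the end. -/
theorem Fin.of_move_to_end {n : ℕ} (Q : (Fin (n + 1) → ℕ) → Prop)
    (hQ : ∀ x i, Q x → Q (Fin.snoc (α := fun _ => ℕ) (x ∘ i.succAbove) (x i)))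
    {x y : Fin (n + 1) → ℕ} (hy : Function.Injective y) (h : ∀ z, (∃ k, x k = z) ↔ ∃ k, y k = z)
    (hx : Q x) : Q y := by
  -- Invariant: after `k` moves the last `k` entries are the first `k` entries of `y`, in order.
  have key : ∀ k ≤ n + 1, ∃ x', Q x' ∧ (∀ z, (∃ k, x' k = z) ↔ ∃ k, y k = z) ∧
      ∀ (j : ℕ) (h₁ : n + 1 - k + j < n + 1) (h₂ : j < n + 1), j < k →
        x' ⟨n + 1 - k + j, h₁⟩ = y ⟨j, h₂⟩ := by
    intro k hk
    induction k with
    | zero => exact ⟨x, hx, h, by omega⟩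
    | succ k ih =>
      obtain ⟨x', h1, h2, h3⟩ := ih (by omega)
      obtain ⟨i, hi⟩ := (h2 (y ⟨k, by omega⟩)).2 ⟨_, rfl⟩
      -- The entry to be moved is not yet in the sorted tail, by injectivity of `y`; hence moving it
      -- shifts the whole tail one place forward.
      have hik : (i : ℕ) < n + 1 - k := by
        by_contra hik
        have h4 := h3 (i - (n + 1 - k)) (by omega) (by omega) (by omega)
        have h5 : (⟨n + 1 - k + (i - (n + 1 - k)), by omega⟩ : Fin (n + 1)) = i :=
          Fin.ext (by simp; omega)
        rw [h5, hi] at h4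
        have h6 := Fin.val_eq_of_eq (hy h4)
        simp only at h6
        omega
      refine ⟨_, hQ x' i h1, fun z => ?_, fun j h₁ h₂ hj => ?_⟩
      · rw [← h2 z]
        constructor
        · rintro ⟨l, rfl⟩
          induction l using Fin.lastCases with
          | last => exact ⟨i, by simp⟩
          | cast l => exact ⟨i.succAbove l, by simp⟩
        · rintro ⟨l, rfl⟩
          by_cases hl : l = i
          · exact ⟨Fin.last n, by simp [hl]⟩
          · obtain ⟨l, rfl⟩ := Fin.exists_succAbove_eq hl
            exact ⟨l.castSucc, by simp⟩
      · by_cases hjk : j = k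
        · subst hjk
          rw [show (⟨n + 1 - (j + 1) + j, h₁⟩ : Fin (n + 1)) = Fin.last n from
            Fin.ext (by simp; omega), Fin.snoc_last, hi]
        · have h4 : n - k + j < n := by omega
          rw [show (⟨n + 1 - (k + 1) + j, h₁⟩ : Fin (n + 1)) = Fin.castSucc ⟨n - k + j, h4⟩ from
            Fin.ext (by simp), Fin.snoc_castSucc, Function.comp_apply,
            Fin.succAbove_of_le_castSucc _ _ (by rw [Fin.le_def]; simp; omega),
            ← h3 j (by omega) h₂ (by omega)]
          congr 1
          exact Fin.ext (by simp; omega)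
  obtain ⟨x', h1, -, h3⟩ := key (n + 1) le_rfl
  have : x' = y := by
    funext j
    have := h3 j (by omega) j.2 j.2
    simpa using this
  exact this ▸ h1

/-! ### Composing free variables with arrows and cutting bound variables -/

namespace OrderedMolecule

variable {G : Type v} {type : G → ℕ × ℕ} {p q n : ℕ}

theorem exists_reorder (M : OrderedMolecule type p q) (inp : Fin p → ℕ) (out : Fin q → ℕ)
    (hi : Function.Injective inp) (ho : Function.Injective out)
    (ri : ∀ z, (∃ k, inp k = z) ↔ ∃ k, M.inp k = z)
    (ro : ∀ z, (∃ k, out k = z) ↔ ∃ k, M.out k = z) :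
    ∃ N : OrderedMolecule type p q, N.atoms = M.atoms ∧ N.inp = inp ∧ N.out = out :=
  exists_mk _ _ _ M.nodup_ins M.nodup_outs hi ho (fun z => by rw [ri, M.mem_range_inp])
    fun z => by rw [ro, M.mem_range_out]

theorem exists_ordering (L : Multiset (Atom type)) (ni : (L.bind Atom.ins).Nodup)
    (no : (L.bind Atom.outs).Nodup) : ∃ p q, ∃ M : OrderedMolecule type p q, M.atoms = L := by
  have key : ∀ s t : Multiset ℕ, ∃ p, ∃ x : Fin p → ℕ, Function.Injective x ∧
      ∀ z, (∃ k, x k = z) ↔ z ∈ s ∧ z ∉ t := fun s t => by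
    refine ⟨_, (s.toFinset \ t.toFinset).orderEmbOfFin rfl,
      (Finset.orderEmbOfFin _ rfl).injective, fun z => ?_⟩
    exact (Set.ext_iff.1 (Finset.range_orderEmbOfFin (s.toFinset \ t.toFinset) rfl) z).trans
      (by simp)
  obtain ⟨p, inp, hi, ri⟩ := key (L.bind Atom.ins) (L.bind Atom.outs)
  obtain ⟨q, out, ho, ro⟩ := key (L.bind Atom.outs) (L.bind Atom.ins)
  obtain ⟨M, hM, -, -⟩ := exists_mk L inp out ni no hi ho ri ro
  exact ⟨p, q, M, hM⟩

/-- The indices `1` and `3` are the images of the variables `0` and `1` of the arrow under `n ↦ 2n +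
1`. -/
theorem atoms_tensor_arrow (M : OrderedMolecule type p q) :
    (M.tensor arrow).atoms =
      Atom.arrow 1 3 ::ₘ M.atoms.map (Atom.map (fun n => 2 * n) (fun n => 2 * n)) := by
  simp only [tensor, disjointUnion, arrow, Multiset.map_singleton, Atom.map]
  rw [add_comm]
  rfl

theorem inp_ne_out (M : OrderedMolecule type p q) (i : Fin p) (j : Fin q) : M.inp i ≠ M.out j :=
  ne_of_mem_of_not_mem (M.inp_mem i).1 (M.out_mem j).2

/-- Composing an input with an arrow moves it to the end. -/
theorem mk_contr_tensor_arrow_inp (M N : OrderedMolecule type (n + 1) q) (i : Fin (n + 1))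
    (hN : N.atoms = M.atoms) (ho : N.out = M.out)
    (hi : N.inp = Fin.snoc (α := fun _ => ℕ) (M.inp ∘ i.succAbove) (M.inp i)) :
    Monomial.contr i.castSucc (Fin.last q) ((Monomial.mk M).tensor (Monomial.mk arrow)) =
      Monomial.mk N := by
  -- Contracting the output of the arrow with input `i` leaves the arrow attached above that input,
  -- and makes the upper index of the arrow the last input.
  let X : OrderedMolecule type (n + 1) q := (M.tensor arrow).contr i.castSucc (Fin.last q)
  have e1 : (M.tensor arrow).inp i.castSucc = 2 * M.inp i :=
    Fin.append_left (fun i => 2 * M.inp i) (fun i => 2 * arrow.inp i + 1) i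
  have e2 : (M.tensor arrow).out (Fin.last q) = 3 :=
    Fin.append_right (fun i => 2 * M.out i) (fun i => 2 * arrow.out i + 1) 0
  have hX : X.atoms = Atom.arrow 1 (2 * M.inp i) ::ₘ
      M.atoms.map (Atom.map (fun n => 2 * n) (fun n => 2 * n)) := by
    change ((M.tensor arrow).atoms.map _) = _
    rw [atoms_tensor_arrow, e1, e2, Multiset.map_cons, Atom.map, subst_self,
      map_subst_out_eq_self _ (by rw [bind_outs_map, Multiset.mem_map]; rintro ⟨a, -, h⟩; omega)]
    rfl
  obtain ⟨X', h1, h2, h3, h4⟩ := X.exists_absorb_in (2 * M.inp i) 1 _ hX (by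
    rw [bind_ins_map]
    exact Multiset.mem_map_of_mem _ (M.inp_mem i).1)
  change Monomial.mk X = _
  rw [h4]
  symm
  -- Absorbing the arrow renames input `i` to its upper index `1`, while the tensor product doubled
  -- all other variables; parity makes this injective.
  let f : ℕ → ℕ := fun v => if v = M.inp i then 1 else 2 * v
  have hf : ∀ {v}, v ≠ M.inp i → f v = 2 * v := fun h => if_neg h
  have hf' : f (M.inp i) = 1 := if_pos rfl
  refine mk_eq_of_map f (fun a b _ _ h => ?_) ?_ ?_ ?_
  · simp only [f] at h
    split_ifs at h <;> omega
  · rw [h1, hN, Multiset.map_atoms_map]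
    refine Multiset.map_atoms_congr _ (fun v _ => ?_) fun v hv => ?_
    · by_cases h : v = M.inp i
      · rw [h, hf']
        exact subst_self _ _
      · rw [hf h]
        exact subst_of_ne _ (by change 2 * v ≠ _; omega)
    · rw [hf (ne_of_mem_of_not_mem hv (M.inp_mem i).2)]
      rfl
  · rw [h2, hi]
    funext k
    change (M.tensor arrow).inp (i.castSucc.succAbove k) = _
    induction k using Fin.lastCases with
    | last =>
      rw [Function.comp_apply, Fin.snoc_last, hf', Fin.succAbove_ne_last_last]
      · exact Fin.append_right (fun i => 2 * M.inp i) (fun i => 2 * arrow.inp i + 1) 0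
      · exact (Fin.castSucc_lt_last i).ne
    | cast k =>
      rw [Function.comp_apply, Fin.snoc_castSucc, Function.comp_apply,
        hf (M.inp_injective.ne (Fin.succAbove_ne i k)), Fin.castSucc_succAbove_castSucc]
      exact Fin.append_left (fun i => 2 * M.inp i) (fun i => 2 * arrow.inp i + 1) _
  · rw [h3, ho]
    funext k
    change (M.tensor arrow).out ((Fin.last q).succAbove k) = f (M.out k)
    rw [hf (M.inp_ne_out i k).symm, Fin.succAbove_last]
    exact Fin.append_left (fun i => 2 * M.out i) (fun i => 2 * arrow.out i + 1) _

/-- Composing an output with an arrow moves it to the end. -/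
theorem mk_contr_tensor_arrow_out (M N : OrderedMolecule type p (n + 1)) (j : Fin (n + 1))
    (hN : N.atoms = M.atoms) (hi : N.inp = M.inp)
    (ho : N.out = Fin.snoc (α := fun _ => ℕ) (M.out ∘ j.succAbove) (M.out j)) :
    Monomial.contr (Fin.last p) j.castSucc ((Monomial.mk M).tensor (Monomial.mk arrow)) =
      Monomial.mk N := by
  let X : OrderedMolecule type p (n + 1) := (M.tensor arrow).contr (Fin.last p) j.castSucc
  have e1 : (M.tensor arrow).out j.castSucc = 2 * M.out j :=
    Fin.append_left (fun i => 2 * M.out i) (fun i => 2 * arrow.out i + 1) j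
  have e2 : (M.tensor arrow).inp (Fin.last p) = 1 :=
    Fin.append_right (fun i => 2 * M.inp i) (fun i => 2 * arrow.inp i + 1) 0
  -- The contraction here changes the lower indices of `M` and not the arrow: output `j` is replaced
  -- by `1`, which the arrow then turns into `3`.
  have hX : X.atoms = Atom.arrow 1 3 ::ₘ
      M.atoms.map (Atom.map (fun n => 2 * n) (subst 1 (2 * M.out j) ∘ fun n => 2 * n)) := by
    change ((M.tensor arrow).atoms.map _) = _
    rw [atoms_tensor_arrow, e1, e2, Multiset.map_cons, Atom.map, subst_of_ne _ (by omega),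
      Multiset.map_atoms_map]
    rfl
  obtain ⟨X', h1, h2, h3, h4⟩ := X.exists_absorb_out 1 3 _ hX (by
    rw [bind_outs_map, Multiset.mem_map]
    exact ⟨M.out j, (M.out_mem j).1, subst_self _ _⟩)
  change Monomial.mk X = _
  rw [h4]
  symm
  let f : ℕ → ℕ := fun v => if v = M.out j then 3 else 2 * v
  have hf : ∀ {v}, v ≠ M.out j → f v = 2 * v := fun h => if_neg h
  have hf' : f (M.out j) = 3 := if_pos rfl
  refine mk_eq_of_map f (fun a b _ _ h => ?_) ?_ ?_ ?_
  · simp only [f] at h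
    split_ifs at h <;> omega
  · rw [h1, hN, Multiset.map_atoms_map]
    refine Multiset.map_atoms_congr _ (fun v hv => ?_) fun v _ => ?_
    · rw [hf (ne_of_mem_of_not_mem hv (M.out_mem j).2)]
      rfl
    · by_cases h : v = M.out j
      · rw [h, hf', Function.comp_apply, Function.comp_apply, subst_self, subst_self]
      · rw [hf h, Function.comp_apply, Function.comp_apply,
          subst_of_ne (y := 2 * M.out j) _ (by omega), subst_of_ne _ (by omega)]
  · rw [h2, hi]
    funext k
    change (M.tensor arrow).inp ((Fin.last p).succAbove k) = f (M.inp k)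
    rw [hf (M.inp_ne_out k j), Fin.succAbove_last]
    exact Fin.append_left (fun i => 2 * M.inp i) (fun i => 2 * arrow.inp i + 1) _
  · rw [h3, ho]
    funext k
    change (M.tensor arrow).out (j.castSucc.succAbove k) = _
    induction k using Fin.lastCases with
    | last =>
      rw [Function.comp_apply, Fin.snoc_last, hf', Fin.succAbove_ne_last_last]
      · exact Fin.append_right (fun i => 2 * M.out i) (fun i => 2 * arrow.out i + 1) 0
      · exact (Fin.castSucc_lt_last j).ne
    | cast k =>
      rw [Function.comp_apply, Fin.snoc_castSucc, Function.comp_apply,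
        hf (M.out_injective.ne (Fin.succAbove_ne j k)), Fin.castSucc_succAbove_castSucc]
      exact Fin.append_left (fun i => 2 * M.out i) (fun i => 2 * arrow.out i + 1) _

/-- Rename the lower occurrence of `x` to a fresh `x'`. Then `x` becomes an input and `x'` an
output; placed first in the orderings, they are rejoined by the contraction. -/
theorem exists_cut (M : OrderedMolecule type p q) {x : ℕ} (hx : x ∈ M.bound) :
    ∃ N : OrderedMolecule type (p + 1) (q + 1), N.contr 0 0 = M ∧
      N.atoms.bind Atom.ins = M.atoms.bind Atom.ins := by
  rw [mem_bound] at hx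
  obtain ⟨x', hx'⟩ := Infinite.exists_notMem_finset
    ((M.atoms.bind Atom.ins).toFinset ∪ (M.atoms.bind Atom.outs).toFinset)
  simp only [Finset.mem_union, Multiset.mem_toFinset, not_or] at hx'
  obtain ⟨t, ht⟩ := Multiset.exists_cons_of_mem hx.2
  have no := M.nodup_outs
  have hri := M.mem_range_inp
  have hro := M.mem_range_out
  have hno : (M.atoms.map (Atom.map id (subst x' x))).bind Atom.outs = x' ::ₘ t := by
    rw [bind_outs_map, map_subst_of_cons ht M.nodup_outs]
  rw [ht] at no hri hro hx'
  rw [Multiset.nodup_cons] at no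
  simp only [Multiset.mem_cons, not_or] at hx' hri hro
  obtain ⟨N, h1, h2, h3⟩ := exists_mk (M.atoms.map (Atom.map id (subst x' x)))
    (Fin.cons (α := fun _ => ℕ) x M.inp) (Fin.cons (α := fun _ => ℕ) x' M.out)
    (by rw [bind_ins_map, Multiset.map_id]; exact M.nodup_ins)
    (by rw [hno, Multiset.nodup_cons]; exact ⟨hx'.2.2, no.2⟩)
    (Fin.cons_injective_iff.2 ⟨fun ⟨k, hk⟩ => (M.inp_mem k).2 (hk ▸ hx.2), M.inp_injective⟩)
    (Fin.cons_injective_iff.2 ⟨fun ⟨k, hk⟩ => by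
      have := (hro x').1 ⟨k, hk⟩
      tauto, M.out_injective⟩)
    (fun z => by
      rw [Fin.exists_fin_succ, hno, bind_ins_map, Multiset.map_id]
      simp only [Fin.cons_zero, Fin.cons_succ, hri, Multiset.mem_cons, not_or]
      constructor
      · rintro (rfl | h)
        · exact ⟨hx.1, fun e => hx'.2.1 e.symm, no.1⟩
        · exact ⟨h.1, fun e => hx'.1 (e ▸ h.1), h.2.2⟩
      · rintro ⟨h, -, h'⟩
        by_cases e : x = z
        · exact .inl e
        · exact .inr ⟨h, fun e' => e e'.symm, h'⟩)
    (fun z => by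
      rw [Fin.exists_fin_succ, hno, bind_ins_map, Multiset.map_id]
      simp only [Fin.cons_zero, Fin.cons_succ, hro, Multiset.mem_cons]
      constructor
      · rintro (rfl | ⟨rfl | h, h'⟩)
        · exact ⟨.inl rfl, hx'.1⟩
        · exact absurd hx.1 h'
        · exact ⟨.inr h, h'⟩
      · rintro ⟨rfl | h, h'⟩
        · exact .inl rfl
        · exact .inr ⟨.inr h, h'⟩)
  refine ⟨N, ext_of ?_ ?_ ?_, by rw [h1, bind_ins_map, Multiset.map_id]⟩
  · simp only [contr, h1, h2, h3, Fin.cons_zero, Multiset.map_atoms_map]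
    refine Multiset.map_atoms_eq_self _ (fun _ _ => rfl) fun v hv => ?_
    by_cases h : v = x
    · simp only [Function.comp_apply, h, subst_self]
    · rw [Function.comp_apply, subst_of_ne _ h, subst_of_ne]
      rintro rfl
      rw [ht, Multiset.mem_cons] at hv
      tauto
  · simp only [contr, h2]
    funext k
    simp
  · simp only [contr, h3]
    funext k
    simp

end OrderedMolecule

/-! ### Generation of monomials by tensor products and contractions -/

namespace Monomial

open OrderedMolecule

variable {G : Type v} {type : G → ℕ × ℕ}

/-- A property of monomials that holds for the unit, the identity and the generators, and is
preserved by tensor products and contractions. -/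
structure IsClosed (P : ∀ p q, Monomial type p q → Prop) : Prop where
  one : P 0 0 (mk empty)
  idn : P 1 1 (mk arrow)
  gen : ∀ A, P _ _ (mk (gen A))
  tensor : ∀ {p₁ q₁ p₂ q₂ : ℕ} (m : Monomial type p₁ q₁) (n : Monomial type p₂ q₂),
    P _ _ m → P _ _ n → P _ _ (m.tensor n)
  contr : ∀ {p q : ℕ} (i : Fin (p + 1)) (j : Fin (q + 1)) (m : Monomial type (p + 1) (q + 1)),
    P _ _ m → P _ _ (m.contr i j)

namespace IsClosed

variable {P : ∀ p q, Monomial type p q → Prop} {p q p' q' : ℕ}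

/-- Moving one input to the end is a tensor product with the identity followed by a contraction, and
such moves reach every ordering. -/
theorem reorder_inp (hP : IsClosed P) {M N : OrderedMolecule type p q}
    (h : N.atoms = M.atoms) (ho : N.out = M.out) (hM : P p q (Monomial.mk M)) : P p q (Monomial.mk N) := by
  cases p with
  | zero =>
    rwa [← mk_eq_of_atoms h (Subsingleton.elim _ _) ho]
  | succ n =>
    obtain ⟨N', h1, h2, h3, h4⟩ := Fin.of_move_to_end
      (fun x => ∃ M' : OrderedMolecule type (n + 1) q, M'.atoms = M.atoms ∧ M'.inp = x ∧
        M'.out = M.out ∧ P _ _ (Monomial.mk M')) (by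
      rintro x i ⟨M', h1, rfl, h3, h4⟩
      obtain ⟨N', h5, h6, h7⟩ := M'.exists_reorder
        (Fin.snoc (α := fun _ => ℕ) (M'.inp ∘ i.succAbove) (M'.inp i)) M'.out
        (Fin.snoc_injective_iff.2 ⟨M'.inp_injective.comp Fin.succAbove_right_injective, by
          rintro ⟨k, hk⟩
          exact Fin.succAbove_ne i k (M'.inp_injective hk)⟩) M'.out_injective
        (fun z => by
          constructor
          · rintro ⟨l, rfl⟩
            induction l using Fin.lastCases with
            | last => exact ⟨i, by simp⟩
            | cast l => exact ⟨i.succAbove l, by simp⟩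
          · rintro ⟨l, rfl⟩
            by_cases hl : l = i
            · exact ⟨Fin.last n, by simp [hl]⟩
            · obtain ⟨l, rfl⟩ := Fin.exists_succAbove_eq hl
              exact ⟨l.castSucc, by simp⟩) (fun z => Iff.rfl)
      refine ⟨N', h5.trans h1, h6, h7.trans h3, ?_⟩
      rw [← mk_contr_tensor_arrow_inp M' N' i h5 h7 h6]
      exact hP.contr _ _ _ (hP.tensor _ _ h4 hP.idn))
      N.inp_injective (x := M.inp) (fun z => by rw [M.mem_range_inp, N.mem_range_inp, h])
      ⟨M, rfl, rfl, rfl, hM⟩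
    rwa [← mk_eq_of_atoms (h.trans h1.symm) h2.symm (ho.trans h3.symm)]

theorem reorder_out (hP : IsClosed P) {M N : OrderedMolecule type p q}
    (h : N.atoms = M.atoms) (hi : N.inp = M.inp) (hM : P p q (Monomial.mk M)) : P p q (Monomial.mk N) := by
  cases q with
  | zero =>
    rwa [← mk_eq_of_atoms h hi (Subsingleton.elim _ _)]
  | succ n =>
    obtain ⟨N', h1, h2, h3, h4⟩ := Fin.of_move_to_end
      (fun x => ∃ M' : OrderedMolecule type p (n + 1), M'.atoms = M.atoms ∧ M'.out = x ∧
        M'.inp = M.inp ∧ P _ _ (Monomial.mk M')) (by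
      rintro x i ⟨M', h1, rfl, h3, h4⟩
      obtain ⟨N', h5, h6, h7⟩ := M'.exists_reorder M'.inp
        (Fin.snoc (α := fun _ => ℕ) (M'.out ∘ i.succAbove) (M'.out i)) M'.inp_injective
        (Fin.snoc_injective_iff.2 ⟨M'.out_injective.comp Fin.succAbove_right_injective, by
          rintro ⟨k, hk⟩
          exact Fin.succAbove_ne i k (M'.out_injective hk)⟩) (fun z => Iff.rfl)
        (fun z => by
          constructor
          · rintro ⟨l, rfl⟩
            induction l using Fin.lastCases with
            | last => exact ⟨i, by simp⟩
            | cast l => exact ⟨i.succAbove l, by simp⟩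
          · rintro ⟨l, rfl⟩
            by_cases hl : l = i
            · exact ⟨Fin.last n, by simp [hl]⟩
            · obtain ⟨l, rfl⟩ := Fin.exists_succAbove_eq hl
              exact ⟨l.castSucc, by simp⟩)
      refine ⟨N', h5.trans h1, h7, h6.trans h3, ?_⟩
      rw [← mk_contr_tensor_arrow_out M' N' i h5 h6 h7]
      exact hP.contr _ _ _ (hP.tensor _ _ h4 hP.idn))
      N.out_injective (x := M.out) (fun z => by rw [M.mem_range_out, N.mem_range_out, h])
      ⟨M, rfl, rfl, rfl, hM⟩
    rwa [← mk_eq_of_atoms (h.trans h1.symm) (hi.trans h3.symm) h2.symm]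

/-- The atoms determine the sets of free variables, hence the bidegree; only the two orderings can
differ. -/
theorem of_atoms_eq (hP : IsClosed P) {M : OrderedMolecule type p q}
    {N : OrderedMolecule type p' q'} (h : N.atoms = M.atoms) (hM : P p q (Monomial.mk M)) : P p' q' (Monomial.mk N) := by
  have card_eq : ∀ {m n : ℕ} {x : Fin m → ℕ} {y : Fin n → ℕ}, Function.Injective x →
      Function.Injective y → Set.range x = Set.range y → m = n := by
    intro m n x y hx hy e
    have h1 := Set.ncard_range_of_injective hx
    have h2 := Set.ncard_range_of_injective hy
    rw [e, h2] at h1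
    simpa using h1.symm
  have ri : Set.range M.inp = Set.range N.inp := by
    rw [M.range_inp, N.range_inp, Molecule.inputVars, Molecule.inputVars, h]
  have ro : Set.range M.out = Set.range N.out := by
    rw [M.range_out, N.range_out, Molecule.outputVars, Molecule.outputVars, h]
  obtain rfl := card_eq M.inp_injective N.inp_injective ri
  obtain rfl := card_eq M.out_injective N.out_injective ro
  obtain ⟨M', h1, h2, h3⟩ := M.exists_reorder N.inp M.out N.inp_injective M.out_injective
    (fun z => (Set.ext_iff.1 ri z).symm) fun z => Iff.rfl
  exact hP.reorder_out (h.trans h1.symm) h2.symm (hP.reorder_inp h1 h3 hM)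

theorem of_rename (hP : IsClosed P) {M : OrderedMolecule type p q}
    {N : OrderedMolecule type p' q'} (σ : Equiv.Perm ℕ)
    (h : N.atoms = M.atoms.map (Atom.map σ σ))
    (hM : P p q (Monomial.mk M)) : P p' q' (Monomial.mk N) := by
  obtain ⟨M', h1, h2, h3⟩ := M.exists_rename σ
  have e : Monomial.mk M = Monomial.mk M' := Quot.sound (.rename _ _ σ h1 h2 h3)
  exact hP.of_atoms_eq (h.trans h1.symm) (e ▸ hM)

/-- Without bound variables all indices of the atom are distinct, so it is a renaming of the
standard generator or arrow. -/
theorem of_singleton (hP : IsClosed P) {M : OrderedMolecule type p q} (a : Atom type)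
    (hM : M.atoms = {a}) (hb : M.bound = 0) : P p q (Monomial.mk M) := by
  have hi := M.bind_ins_eq
  have ho := M.bind_outs_eq
  have ni := M.nodup_ins
  have no := M.nodup_outs
  have nf := M.nodup_free
  rw [hb, add_zero] at hi ho
  rw [← hi, ← ho] at nf
  simp only [hM, Multiset.singleton_bind] at ni no nf
  cases a with
  | gen A x y =>
    obtain ⟨σ, -, hσ⟩ := Finset.exists_perm_of_pairs ∅
      (Finset.univ.val.map (fun k => ((OrderedMolecule.gen (type := type) A).inp k, x k)) +
        Finset.univ.val.map (fun k => ((OrderedMolecule.gen (type := type) A).out k, y k)))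
      (by simpa [Function.comp_def] using (OrderedMolecule.gen (type := type) A).nodup_free)
      (by simpa [Function.comp_def, Atom.ins, Atom.outs] using nf) (by simp) (by simp)
    refine hP.of_rename σ ?_ (hP.gen A)
    rw [hM]
    simp only [OrderedMolecule.gen, Multiset.map_singleton, Atom.map, Multiset.singleton_inj,
      Atom.gen.injEq, heq_eq_eq, true_and]
    refine ⟨funext fun k => ?_, funext fun k => ?_⟩
    · exact (hσ (_, x k)
        (Multiset.mem_add.2 (.inl (Multiset.mem_map_of_mem _ (Finset.mem_univ k))))).symm
    · exact (hσ (_, y k)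
        (Multiset.mem_add.2 (.inr (Multiset.mem_map_of_mem _ (Finset.mem_univ k))))).symm
  | arrow x y =>
    obtain ⟨σ, -, hσ⟩ := Finset.exists_perm_of_pairs ∅ {(0, x), (1, y)} (by simp)
      (by simpa [Atom.ins, Atom.outs, Multiset.nodup_add] using nf) (by simp) (by simp)
    refine hP.of_rename σ ?_ hP.idn
    rw [hM]
    simp only [OrderedMolecule.arrow, Multiset.map_singleton, Atom.map, Multiset.singleton_inj,
      Atom.arrow.injEq]
    exact ⟨(hσ (0, x) (by simp)).symm, (hσ (1, y) (by simp)).symm⟩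

/-- Without bound variables no two atoms share a variable, so one atom can be split off as a tensor
factor. -/
theorem of_bound_eq_zero (hP : IsClosed P) (L : Multiset (Atom type)) :
    ∀ {p q : ℕ} (M : OrderedMolecule type p q), M.atoms = L → M.bound = 0 → P p q (Monomial.mk M) := by
  induction L using Multiset.induction_on with
  | empty => exact fun M hM _ => hP.of_atoms_eq (M := empty) hM hP.one
  | cons a L ih =>
    intro p q M hM hb
    have ni := M.nodup_ins
    have no := M.nodup_outs
    have hb' : ∀ v, v ∈ M.atoms.bind Atom.ins → v ∉ M.atoms.bind Atom.outs := fun v h1 h2 =>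
      absurd (mem_bound.2 ⟨h1, h2⟩) (by simp [hb])
    simp only [hM, Multiset.cons_bind, Multiset.nodup_add, Multiset.mem_add] at ni no hb'
    have di : ∀ v, v ∈ a.ins → v ∉ L.bind Atom.ins := fun v => Multiset.disjoint_left.1 ni.2.2
    have d_o : ∀ v, v ∈ a.outs → v ∉ L.bind Atom.outs := fun v => Multiset.disjoint_left.1 no.2.2
    obtain ⟨p₁, q₁, M₁, h₁⟩ := exists_ordering {a} (by simpa using ni.1) (by simpa using no.1)
    obtain ⟨p₂, q₂, M₂, h₂⟩ := exists_ordering L ni.2.1 no.2.1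
    have b₁ : M₁.bound = 0 := Multiset.eq_zero_of_forall_notMem fun v hv => by
      simp only [mem_bound, h₁, Multiset.singleton_bind] at hv
      exact hb' v (.inl hv.1) (.inl hv.2)
    have b₂ : M₂.bound = 0 := Multiset.eq_zero_of_forall_notMem fun v hv => by
      simp only [mem_bound, h₂] at hv
      exact hb' v (.inr hv.1) (.inr hv.2)
    have key := hP.tensor _ _ (hP.of_singleton a h₁ b₁) (ih M₂ h₂ b₂)
    have mem : ∀ v, (v ∈ (M₁.tensor M₂).atoms.bind Atom.ins ∨
        v ∈ (M₁.tensor M₂).atoms.bind Atom.outs) →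
        (v % 2 = 0 ∧ (v / 2 ∈ a.ins ∨ v / 2 ∈ a.outs)) ∨
        (v % 2 = 1 ∧ (v / 2 ∈ L.bind Atom.ins ∨ v / 2 ∈ L.bind Atom.outs)) := by
      intro v hv
      simp only [OrderedMolecule.tensor, bind_ins_disjointUnion, bind_outs_disjointUnion] at hv
      obtain ⟨c, rfl | rfl⟩ : ∃ c, v = 2 * c ∨ v = 2 * c + 1 := ⟨v / 2, by omega⟩
      · rw [even_mem, even_mem, h₁, Multiset.singleton_bind, Multiset.singleton_bind] at hv
        rw [show 2 * c / 2 = c by omega]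
        exact .inl ⟨by omega, hv⟩
      · rw [odd_mem, odd_mem, h₂] at hv
        rw [show (2 * c + 1) / 2 = c by omega]
        exact .inr ⟨by omega, hv⟩
    -- Halving undoes the renaming apart. It is injective on the occurring variables because `a` and
    -- `L` have none in common.
    obtain ⟨σ, hσ⟩ := Finset.exists_perm_extending
      (((M₁.tensor M₂).atoms.bind Atom.ins).toFinset ∪
        ((M₁.tensor M₂).atoms.bind Atom.outs).toFinset) (fun v => v / 2) (by
      intro v hv v' hv' e
      simp only [Finset.coe_union, Set.mem_union, Finset.mem_coe, Multiset.mem_toFinset] at hv hv' e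
      rcases mem v hv with ⟨h1, h2⟩ | ⟨h1, h2⟩ <;> rcases mem v' hv' with ⟨h3, h4⟩ | ⟨h3, h4⟩
      · omega
      · rw [e] at h2
        have := di (v' / 2)
        have := d_o (v' / 2)
        have := hb' (v' / 2)
        tauto
      · rw [e] at h2
        have := di (v' / 2)
        have := d_o (v' / 2)
        have := hb' (v' / 2)
        tauto
      · omega)
    simp only [Finset.mem_union, Multiset.mem_toFinset] at hσ
    refine hP.of_rename (M := M₁.tensor M₂) σ ?_ key
    rw [Multiset.map_atoms_congr (f' := fun v => v / 2) (g' := fun v => v / 2) _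
      (fun v hv => hσ v (.inl hv)) fun v hv => hσ v (.inr hv), hM]
    simp only [OrderedMolecule.tensor, disjointUnion, h₁, h₂]
    rw [Multiset.map_add, Multiset.map_atoms_map, Multiset.map_atoms_map,
      Multiset.map_atoms_eq_self, Multiset.map_atoms_eq_self, Multiset.singleton_add]
    all_goals
      intro v _
      simp only [Function.comp_apply]
      omega

/-- The free wheeled PROP is generated by its generators. -/
theorem forall_mk (hP : IsClosed P) (n : ℕ) : ∀ {p q : ℕ} (M : OrderedMolecule type p q),
    M.bound.card = n → P p q (Monomial.mk M) := by
  induction n with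
  | zero => exact fun M hM => hP.of_bound_eq_zero _ M rfl (Multiset.card_eq_zero.1 hM)
  | succ n ih =>
    intro p q M hM
    obtain ⟨x, hx⟩ := Multiset.card_pos_iff_exists_mem.1 (by omega : 0 < M.bound.card)
    obtain ⟨N, rfl, h⟩ := M.exists_cut hx
    refine hP.contr 0 0 (Monomial.mk N) (ih N ?_)
    -- The cut keeps the upper indices and adds one input, so the number of bound variables drops by
    -- one.
    have h1 := congrArg Multiset.card (N.contr 0 0).bind_ins_eq
    rw [← h, N.bind_ins_eq] at h1
    simp only [Multiset.card_add, Multiset.card_map, Finset.card_val, Finset.card_univ,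
      Fintype.card_fin] at h1
    omega

theorem of_monomial (hP : IsClosed P) (m : Monomial type p q) : P p q m := by
  induction m using Quot.ind with
  | mk M => exact hP.forall_mk _ M rfl

end IsClosed

end Monomial

/-! ### Homomorphisms and the universal property -/

namespace PreWheeledPROP

variable {K : Type u} [Field K]

theorem Hom.ext_app {R : PreWheeledPROP.{u, t} K} {S : PreWheeledPROP.{u, t'} K} {φ χ : R.Hom S}
    (h : ∀ p q, φ.app p q = χ.app p q) : φ = χ := by
  cases φ
  cases χ
  congr
  exact funext fun p => funext fun q => h p q

/-- Composition of homomorphisms. -/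
def Hom.comp {Q : PreWheeledPROP.{u, w} K} {R : PreWheeledPROP.{u, t} K}
    {S : PreWheeledPROP.{u, t'} K} (χ : R.Hom S) (φ : Q.Hom R) : Q.Hom S where
  app p q := χ.app p q ∘ₗ φ.app p q
  map_one := by rw [LinearMap.comp_apply, φ.map_one, χ.map_one]
  map_idn := by rw [LinearMap.comp_apply, φ.map_idn, χ.map_idn]
  map_tensor a b := by
    simp only [LinearMap.comp_apply, φ.map_tensor, χ.map_tensor]
  map_contr i j a := by
    simp only [LinearMap.comp_apply, φ.map_contr, χ.map_contr]

end PreWheeledPROP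

namespace FreeWheeledPROP

variable {K : Type u} [Field K] {G : Type v} {type : G → ℕ × ℕ}

section Subst

variable {H : Type w} {typeH : H → ℕ × ℕ} (ψ : ∀ A : G, Monomial typeH (type A).1 (type A).2 →₀ K)

/-- Substitution of linear combinations of monomials for the generators in a monomial. -/
noncomputable def substMonomialClass {p q : ℕ} (m : Monomial type p q) : Monomial typeH p q →₀ K :=
  Quot.lift (substMolecule ψ) (fun _ _ => substMolecule_of_move ψ) m

/-- The linear extension of `substMonomialClass`. -/
noncomputable def substApp (p q : ℕ) :
    (Monomial type p q →₀ K) →ₗ[K] (Monomial typeH p q →₀ K) :=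
  Finsupp.linearCombination K (substMonomialClass ψ)

theorem substApp_single {p q : ℕ} (M : OrderedMolecule type p q) :
    substApp ψ p q (.single (Monomial.mk M) 1) = substMolecule ψ M := by
  rw [substApp, Finsupp.linearCombination_single, one_smul]
  rfl

theorem substApp_tensor {p₁ q₁ p₂ q₂ : ℕ} (a : Monomial type p₁ q₁ →₀ K)
    (b : Monomial type p₂ q₂ →₀ K) :
    substApp ψ _ _ (freeTensor K type a b) =
      freeTensor K typeH (substApp ψ _ _ a) (substApp ψ _ _ b) := by
  have h : (freeTensor K type).compr₂ (substApp ψ (p₁ + p₂) (q₁ + q₂)) =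
      (freeTensor K typeH).compl₁₂ (substApp ψ p₁ q₁) (substApp ψ p₂ q₂) := by
    refine Finsupp.lhom_ext' fun m => LinearMap.ext_ring (Finsupp.lhom_ext' fun n =>
      LinearMap.ext_ring ?_)
    induction m using Quot.ind with | mk M =>
    induction n using Quot.ind with | mk N =>
    change substApp ψ _ _ (freeTensor K type (.single (Monomial.mk M) 1)
      (.single (Monomial.mk N) 1)) = freeTensor K typeH
        (substApp ψ _ _ (.single (Monomial.mk M) 1)) (substApp ψ _ _ (.single (Monomial.mk N) 1))
    rw [freeTensor_single, substApp_single, substApp_single, ← substMolecule_tensor]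
    exact substApp_single ψ (M.tensor N)
  exact LinearMap.congr_fun₂ h a b

theorem substApp_contr {p q : ℕ} (i : Fin (p + 1)) (j : Fin (q + 1))
    (a : Monomial type (p + 1) (q + 1) →₀ K) :
    substApp ψ _ _ (Finsupp.lmapDomain K K (Monomial.contr i j) a) =
      Finsupp.lmapDomain K K (Monomial.contr i j) (substApp ψ _ _ a) := by
  have h : substApp ψ p q ∘ₗ Finsupp.lmapDomain K K (Monomial.contr i j) =
      Finsupp.lmapDomain K K (Monomial.contr i j) ∘ₗ substApp ψ (p + 1) (q + 1) := by
    refine Finsupp.lhom_ext' fun m => LinearMap.ext_ring ?_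
    induction m using Quot.ind with | mk M =>
    change substApp ψ _ _ (Finsupp.mapDomain (Monomial.contr i j) (.single (Monomial.mk M) 1)) =
      Finsupp.lmapDomain K K (Monomial.contr i j) (substApp ψ _ _ (.single (Monomial.mk M) 1))
    rw [Finsupp.mapDomain_single, substApp_single, ← substMolecule_contr]
    exact substApp_single ψ (M.contr i j)
  exact LinearMap.congr_fun h a

/-- The homomorphism of free wheeled PROPs that sends the generators to given elements. -/
noncomputable def substHom : (FreeWheeledPROP K type).Hom (FreeWheeledPROP K typeH) where
  app := substApp ψ
  map_one := (substApp_single ψ _).trans (substMolecule_empty ψ)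
  map_idn := (substApp_single ψ _).trans (substMolecule_arrow ψ)
  map_tensor := substApp_tensor ψ
  map_contr := substApp_contr ψ

theorem substHom_of (A : G) : (substHom ψ).app _ _ (of K type A) = ψ A :=
  (substApp_single ψ _).trans (substMolecule_gen ψ A)

end Subst

/-- A homomorphism from a free wheeled PROP is determined by its values on the generators. -/
theorem hom_ext {R : PreWheeledPROP.{u, t} K} {φ χ : (FreeWheeledPROP K type).Hom R}
    (h : ∀ A, φ.app _ _ (of K type A) = χ.app _ _ (of K type A)) : φ = χ := by
  let s : ∀ {p q : ℕ}, Monomial type p q → (FreeWheeledPROP K type).obj p q := fun m =>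
    (Finsupp.single m 1 : Monomial type _ _ →₀ K)
  have tensor_s : ∀ {p₁ q₁ p₂ q₂ : ℕ} (m : Monomial type p₁ q₁) (n : Monomial type p₂ q₂),
      s (m.tensor n) = (FreeWheeledPROP K type).tensor (s m) (s n) :=
    fun m n => (freeTensor_single m n).symm
  have contr_s : ∀ {p q : ℕ} (i : Fin (p + 1)) (j : Fin (q + 1))
      (m : Monomial type (p + 1) (q + 1)),
      s (m.contr i j) = (FreeWheeledPROP K type).contr i j (s m) :=
    fun i j m => (Finsupp.mapDomain_single (f := Monomial.contr i j)).symm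
  -- The monomials on which two homomorphisms agree form a closed class.
  have key : Monomial.IsClosed (type := type)
      (fun p q m => φ.app p q (s m) = χ.app p q (s m)) :=
    { one := φ.map_one.trans χ.map_one.symm
      idn := φ.map_idn.trans χ.map_idn.symm
      gen := h
      tensor := fun m n hm hn => by rw [tensor_s, φ.map_tensor, χ.map_tensor, hm, hn]
      contr := fun i j m hm => by rw [contr_s, φ.map_contr, χ.map_contr, hm] }
  refine PreWheeledPROP.Hom.ext_app fun p q => ?_
  have : ∀ f g : (Monomial type p q →₀ K) →ₗ[K] R.obj p q,
      (∀ m, f (.single m 1) = g (.single m 1)) → f = g := fun f g hfg =>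
    Finsupp.lhom_ext' fun m => LinearMap.ext_ring (hfg m)
  exact this _ _ fun m => key.of_monomial m

end FreeWheeledPROP

theorem mainTheorem11 {K : Type u} [Field K] {G : Type v} (type : G → ℕ × ℕ)
    (R : PreWheeledPROP.{u, t} K) (hR : PreWheeledPROP.IsWheeledPROP.{u, w, t} R)
    (ψ : ∀ A : G, R.obj (type A).1 (type A).2) :
    ∃! φ : PreWheeledPROP.Hom (FreeWheeledPROP K type) R,
      ∀ A : G, φ.app (type A).1 (type A).2 (FreeWheeledPROP.of K type A) = ψ A := by

  obtain ⟨H, typeH, π, hπ⟩ := hR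
  -- The preimages under `π` are arbitrary; uniqueness is independent of the choice.
  choose ψ' hψ' using fun A => hπ _ _ (ψ A)
  refine ⟨π.comp (FreeWheeledPROP.substHom ψ'), fun A => ?_, fun χ hχ =>
    FreeWheeledPROP.hom_ext fun A => ?_⟩
  · exact (congrArg _ (FreeWheeledPROP.substHom_of ψ' A)).trans (hψ' A)
  · exact (hχ A).trans
      ((congrArg _ (FreeWheeledPROP.substHom_of ψ' A)).trans (hψ' A)).symm
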